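/- There is a universal constant $c>0$ such that the following holds. Let $d\ge n\ge 4$ and $k\ge 2$ be integers, and let $\sigma>0$, $\gamma\ge 0$ and $R\ge \sigma/\sqrt n$ be real. Then there is a matrix $X\in\mathbb R^{n\times d}$ whose columns satisfy $\|X_j\|_2/\sqrt n\le 1$ for all $j$, such that for every $H$ and every regularizer $\rho:\mathbb R^d\to\mathbb R$ with the properties (i) $\rho(\theta)=\sum_{j=1}^d\rho_j(\theta_j)$ for some $\rho_j:\mathbb R\to\mathbb R$; (ii) $\rho_j(0)=0$ and $\rho_j(t)=\rho_j(-t)$ for all $t$; (iii) $\rho_j$ is nondecreasing on $[0,\infty)$; (iv) $\rho_j$ is continuous at $0$; (v) $\rho_j$ is differentiable on $(0,\infty)$ with $|\rho_j'(x)-\rho_j'(\tilde x)|\le H|x-\tilde x|$ for all $x,\tilde x>0$, both (a) and (b) hold. Here, for $y\in\mathbb R^n$ and $\lambda\ge0$, $L(\theta;\lambda)=\frac1n\|y-X\theta\|_2^2+\lambda\rho(\theta)$. A stepsize $\eta>0$ is called admissible for $\lambda$ if $\eta\le\min\{B,\,B/(\lambda H)\}$ with $B=\sigma/(4\sqrt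 n)$ (and $B/0=+\infty$). The local descent method takes $\theta^{t+1}$ to be a minimizer of $L(\cdot;\lambda)$ over the closed Euclidean ball of radius $\eta$ around $\theta^t$ that is closest to $\theta^t$ among all such minimizers, further ties being resolved arbitrarily. It terminates at the first step $t=T$ at which some minimizer over this ball lies in the interior of the ball, and outputs $\widehat\theta=\theta^{T+1}$. (a) For all $y\in\mathbb R^n$, $\lambda\ge 0$, admissible $\eta$ and $\theta^0\in\mathbb R^d$, the method can be run from $\theta^0$, and every run terminates after a finite number of steps at a point $\widehat\theta$ that is a local minimum of $L(\cdot;\lambda)$. (b) Let $y=X\theta^*+w$ with independent $w\sim N(0,\sigma^2I_n)$ and $\theta^0\sim N(0,\gamma^2I_d)$. Then $$\sup_{\substack{\|\theta^*\|_0\le k\\ \|\theta^*\|_1\le R}}\ \mathbb E\Big[\inf_{\lambda\ge0}\ \inf_{\eta,\,\widehat\theta}\ \frac1n\|X\widehat\theta-X\theta^*\|_2^2\Big]\ \ge\ c\,\min\{R,\sigma\}\,\frac{\sigma}{\sqrt n},$$ where the inner infimum is over all stepsizes $\eta$ admissible for $\lambda$ and all outputs $\widehat\theta$ that the method with parameters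 $\lambda,\eta$ can produce from $\theta^0$, whatever the tie-breaking; $\mathbb E$ denotes the lower expectation (the supremum of the expectations of measurable functions below the integrand), which is the expectation when the integrand is measurable. -/

import Mathlib

open MeasureTheory ProbabilityTheory
open scoped ENNReal

noncomputable section

namespace LocalDescent

/-- Column normalization: `‖X_j‖₂ / √n ≤ 1` for every column `X_j` of `X`. -/
def ColumnNormalized {n d : ℕ} (X : Matrix (Fin n) (Fin d) ℝ) : Prop :=
  ∀ j, ‖WithLp.toLp 2 (fun i => X i j)‖ / √(n : ℝ) ≤ 1

/-- The conditions (ii)-(v) on one univariate component `ρ` of a regularizer, with constant `H`. -/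
structure IsComponent (H : ℝ) (ρ : ℝ → ℝ) : Prop where
  zero : ρ 0 = 0
  symm : ∀ t, ρ t = ρ (-t)
  mono : MonotoneOn ρ (Set.Ici 0)
  cont : ContinuousAt ρ 0
  diff : ∀ x, 0 < x → DifferentiableAt ℝ ρ x
  lip : ∀ x x', 0 < x → 0 < x' → |deriv ρ x - deriv ρ x'| ≤ H * |x - x'|

/-- A coordinate-separable regularizer all of whose components satisfy (ii)-(v). -/
def IsRegularizer {d : ℕ} (H : ℝ) (reg : EuclideanSpace ℝ (Fin d) → ℝ) : Prop :=
  ∃ ρ : Fin d → ℝ → ℝ, (∀ θ, reg θ = ∑ j, ρ j (θ j)) ∧ ∀ j, IsComponent H (ρ j)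

/-- The vector `X θ`, as an element of Euclidean space. -/
def apply {n d : ℕ} (X : Matrix (Fin n) (Fin d) ℝ) (θ : EuclideanSpace ℝ (Fin d)) :
    EuclideanSpace ℝ (Fin n) :=
  WithLp.toLp 2 (X.mulVec (WithLp.ofLp θ))

/-- The regularized least-squares cost `L(θ; lam) = (1/n) ‖y - X θ‖₂² + lam * reg θ`. -/
def loss {n d : ℕ} (X : Matrix (Fin n) (Fin d) ℝ) (reg : EuclideanSpace ℝ (Fin d) → ℝ)
    (y : EuclideanSpace ℝ (Fin n)) (lam : ℝ) (θ : EuclideanSpace ℝ (Fin d)) : ℝ :=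
  1 / (n : ℝ) * ‖y - apply X θ‖ ^ 2 + lam * reg θ

/-- The prediction error `(1/n) ‖X θ - X θ'‖₂²`. -/
def predErr {n d : ℕ} (X : Matrix (Fin n) (Fin d) ℝ) (θ θ' : EuclideanSpace ℝ (Fin d)) : ℝ :=
  1 / (n : ℝ) * ‖apply X θ - apply X θ'‖ ^ 2

/-- The set of minimizers of `L` over the closed Euclidean ball of radius `η` around `x`. -/
def ballArgmin {d : ℕ} (L : EuclideanSpace ℝ (Fin d) → ℝ) (η : ℝ)
    (x : EuclideanSpace ℝ (Fin d)) : Set (EuclideanSpace ℝ (Fin d)) :=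
  {z | z ∈ Metric.closedBall x η ∧ ∀ z' ∈ Metric.closedBall x η, L z ≤ L z'}

/-- `z` is a possible successor of the iterate `x`: a minimizer of `L` over the ball around `x`
that is as close to `x` as any other such minimizer (remaining ties may be resolved in any way). -/
def IsStep {d : ℕ} (L : EuclideanSpace ℝ (Fin d) → ℝ) (η : ℝ)
    (x z : EuclideanSpace ℝ (Fin d)) : Prop :=
  z ∈ ballArgmin L η x ∧ ∀ z' ∈ ballArgmin L η x, dist z x ≤ dist z' x

/-- The termination criterion at the iterate `x`: some minimizer of `L` over the ball around `x`
lies in the interior of this ball. -/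
def Stops {d : ℕ} (L : EuclideanSpace ℝ (Fin d) → ℝ) (η : ℝ)
    (x : EuclideanSpace ℝ (Fin d)) : Prop :=
  ∃ z ∈ ballArgmin L η x, dist z x < η

/-- The algorithm terminates at step `T` along `θ`, so that its output is `θ (T + 1)`. -/
def TerminatesAt {d : ℕ} (L : EuclideanSpace ℝ (Fin d) → ℝ) (η : ℝ)
    (θ : ℕ → EuclideanSpace ℝ (Fin d)) (T : ℕ) : Prop :=
  (∀ t < T, ¬ Stops L η (θ t)) ∧ Stops L η (θ T)

/-- The possible outputs of the algorithm started at `θ₀`. -/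
def outputs {d : ℕ} (L : EuclideanSpace ℝ (Fin d) → ℝ) (η : ℝ)
    (θ₀ : EuclideanSpace ℝ (Fin d)) : Set (EuclideanSpace ℝ (Fin d)) :=
  {θhat | ∃ (θ : ℕ → EuclideanSpace ℝ (Fin d)) (T : ℕ), θ 0 = θ₀ ∧
    (∀ t ≤ T, IsStep L η (θ t) (θ (t + 1))) ∧ TerminatesAt L η θ T ∧ θhat = θ (T + 1)}

/-- `0 < η ≤ min {B, B / (lam * H)}` with `B = σ / (4 √n)`, where `B / 0` means `+∞`. -/
def AdmissibleStepsize (n : ℕ) (σ H lam η : ℝ) : Prop :=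
  0 < η ∧ η ≤ σ / (4 * √(n : ℝ)) ∧ η * (lam * H) ≤ σ / (4 * √(n : ℝ))

/-- Vectors with at most `k` nonzero coordinates and `ℓ₁`-norm at most `R`. -/
def sparseBall (d k : ℕ) (R : ℝ) : Set (EuclideanSpace ℝ (Fin d)) :=
  {θ | {j | θ j ≠ 0}.ncard ≤ k ∧ ∑ j, |θ j| ≤ R}

/-- The isotropic Gaussian law `N(0, s² I)` on `ℝᵐ`. -/
def isoGaussian (m : ℕ) (s : ℝ) : Measure (EuclideanSpace ℝ (Fin m)) :=
  (Measure.pi fun _ : Fin m => gaussianReal 0 (Real.toNNReal (s ^ 2))).map (WithLp.toLp 2)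

end LocalDescent

end

/-! Write `τ = σ / √n` and `r = min R σ`. The design consists of `n / 2` blocks whose two columns
are proportional to `(1/2, u)` and `(-1/2, u)`. A signal with equal entries `r / 2` on one pair is
visible only through the weak row `u`, where `u ^ 2 * r = τ / 4`. Only the size of `lam * ρ_j'` on
`(0, τ/4]` matters. In each pair select the coordinate with the smaller supremum of `ρ_j'`, and let
the pair `i₀` maximizing this smaller supremum carry the signal. For each `lam` there are two cases
(`exists_steep_or_flat`). Steep: both coordinates of `i₀` have a point in `(0, τ/4]` where the
penalty slope is at least `3 * τ`. If the noise on `i₀` is moderate and the start is nonpositive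
there, the data pull with slope at most `21/8 * τ`. The step is too short for the penalty slope to
drop below `11/4 * τ`, so no iterate passes these points (`IsStep.le_of_steep`). The signal is
missed and the error is at least `u ^ 2 * (r / 2) ^ 2 = τ * r / 16`. Flat: every selected slope is
at most `3 * τ` on `(0, τ/4)`. On each other pair, with constant probability, the noise pulls the
selected coordinate harder than that, so every local minimum is wrong there
(`exists_le_abs_of_flat`), at cost `u ^ 2 * τ ^ 2 / 8`. Over about `n / 2` pairs this is of order `σ
^ 2 * τ / r`, hence at least of order `r * τ` because `r ≤ σ`. The pair `i₀` and the selection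
depend on the regularizer alone, so one target serves all `lam`, and the infimum over `lam` and `η`
can be taken inside the expectation. Termination follows from boundedness of runs: near a cluster
point, that point is itself an interior minimizer of the ball. -/

namespace LocalDescent

/-! ### Local descent for a continuous cost: existence of runs, termination, invariant sets. -/

section Descent

variable {d : ℕ} {L : EuclideanSpace ℝ (Fin d) → ℝ} {η : ℝ}

theorem exists_isStep (hL : Continuous L) (hη : 0 ≤ η) (x : EuclideanSpace ℝ (Fin d)) :
    ∃ z, IsStep L η x z := by
  have hK : IsCompact (Metric.closedBall x η) := isCompact_closedBall x η
  obtain ⟨z, hz, hmin⟩ := hK.exists_isMinOn ⟨x, Metric.mem_closedBall_self hη⟩ hL.continuousOn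
  have hA : ballArgmin L η x = Metric.closedBall x η ∩ L ⁻¹' Set.Iic (L z) := by
    ext a
    constructor
    · exact fun h => ⟨h.1, h.2 z hz⟩
    · exact fun h => ⟨h.1, fun b hb => le_trans h.2 (hmin hb)⟩
  have hcomp : IsCompact (ballArgmin L η x) := by
    rw [hA]; exact hK.inter_right (isClosed_Iic.preimage hL)
  obtain ⟨a, ha, hmin'⟩ := hcomp.exists_isMinOn ⟨z, hz, fun b hb => hmin hb⟩
    (continuous_id.dist continuous_const : Continuous fun a => dist a x).continuousOn
  exact ⟨a, ha, fun b hb => hmin' hb⟩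

theorem IsStep.le {x z : EuclideanSpace ℝ (Fin d)} (h : IsStep L η x z) (hη : 0 ≤ η) :
    L z ≤ L x :=
  h.1.2 x (Metric.mem_closedBall_self hη)

/-- The closest-minimizer rule puts `z` in the open ball as soon as any minimizer lies there. -/
theorem IsStep.isLocalMin {x z : EuclideanSpace ℝ (Fin d)} (h : IsStep L η x z)
    (hs : Stops L η x) : IsLocalMin L z := by
  obtain ⟨a, ha, hlt⟩ := hs
  have hz : z ∈ Metric.ball x η := lt_of_le_of_lt (h.2 a ha) hlt
  filter_upwards [Metric.isOpen_ball.mem_nhds hz] with b hb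
  exact h.1.2 b (Metric.ball_subset_closedBall hb)

/-- A bounded run of the method satisfies the termination criterion at some iterate. -/
theorem exists_stops_of_isBounded (hL : Continuous L) (hη : 0 < η)
    {θ : ℕ → EuclideanSpace ℝ (Fin d)} (hstep : ∀ t, IsStep L η (θ t) (θ (t + 1)))
    (hb : Bornology.IsBounded (Set.range θ)) : ∃ T, Stops L η (θ T) := by
  obtain ⟨x, -, φ, hφ, hlim⟩ := tendsto_subseq_of_bounded hb (fun t => Set.mem_range_self t)
  have hanti : Antitone fun t => L (θ t) := antitone_nat_of_succ_le fun t => (hstep t).le hη.le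
  have hLlim : Filter.Tendsto (fun t => L (θ (φ t))) Filter.atTop (nhds (L x)) :=
    (hL.tendsto x).comp hlim
  have hge : ∀ t, L x ≤ L (θ t) := fun t =>
    le_of_tendsto hLlim <| by
      filter_upwards [Filter.eventually_ge_atTop t] with s hs
      exact hanti (hs.trans hφ.le_apply)
  obtain ⟨N, hN⟩ := (Metric.tendsto_atTop.1 hlim) η hη
  have hd : dist x (θ (φ N)) < η := by rw [dist_comm]; exact hN N le_rfl
  -- The cluster point `x` is an interior minimizer: `L x` is below every value along the run, in
  -- particular below the minimum over this ball, attained at the next iterate.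
  refine ⟨φ N, x, ⟨hd.le, fun z' hz' => ?_⟩, hd⟩
  exact (hge _).trans ((hstep (φ N)).1.2 z' hz')

theorem exists_terminatesAt_isLocalMin (hL : Continuous L) (hη : 0 < η)
    {θ : ℕ → EuclideanSpace ℝ (Fin d)} (hstep : ∀ t, IsStep L η (θ t) (θ (t + 1)))
    (hb : Bornology.IsBounded (Set.range θ)) :
    ∃ T, TerminatesAt L η θ T ∧ IsLocalMin L (θ (T + 1)) := by
  classical
  have h := exists_stops_of_isBounded hL hη hstep hb
  exact ⟨Nat.find h, ⟨fun t ht => Nat.find_min h ht, Nat.find_spec h⟩,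
    (hstep _).isLocalMin (Nat.find_spec h)⟩

theorem exists_run (hL : Continuous L) (hη : 0 ≤ η) (θ₀ : EuclideanSpace ℝ (Fin d)) :
    ∃ θ : ℕ → EuclideanSpace ℝ (Fin d), θ 0 = θ₀ ∧ ∀ t, IsStep L η (θ t) (θ (t + 1)) := by
  choose f hf using exists_isStep hL hη
  refine ⟨fun t => f^[t] θ₀, rfl, fun t => ?_⟩
  simp only [Function.iterate_succ_apply']
  exact hf _

theorem isLocalMin_of_mem_outputs {θ₀ z : EuclideanSpace ℝ (Fin d)} (hz : z ∈ outputs L η θ₀) :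
    IsLocalMin L z := by
  obtain ⟨θ, T, -, hstep, hT, rfl⟩ := hz
  exact (hstep T le_rfl).isLocalMin hT.2

/-- A set containing the initial point and stable under steps contains all outputs. -/
theorem mem_of_mem_outputs {θ₀ z : EuclideanSpace ℝ (Fin d)} (hz : z ∈ outputs L η θ₀)
    {S : Set (EuclideanSpace ℝ (Fin d))} (h₀ : θ₀ ∈ S)
    (hS : ∀ x ∈ S, ∀ x', IsStep L η x x' → x' ∈ S) : z ∈ S := by
  obtain ⟨θ, T, h0, hstep, -, rfl⟩ := hz
  have : ∀ t ≤ T + 1, θ t ∈ S := by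
    intro t
    induction t with
    | zero => intro _; rw [h0]; exact h₀
    | succ t ih => intro ht; exact hS _ (ih (by omega)) _ (hstep t (by omega))
  exact this _ le_rfl

end Descent

/-! ### Regularity of the univariate penalties. -/

section Component

variable {H : ℝ} {ρ : ℝ → ℝ}

theorem IsComponent.apply_abs (h : IsComponent H ρ) (t : ℝ) : ρ |t| = ρ t := by
  rcases abs_choice t with h' | h' <;> rw [h']
  exact (h.symm t).symm

theorem IsComponent.le_of_abs_le (h : IsComponent H ρ) {s t : ℝ} (hst : |s| ≤ |t|) :
    ρ s ≤ ρ t := by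
  rw [← h.apply_abs s, ← h.apply_abs t]
  exact h.mono (abs_nonneg s) (abs_nonneg t) hst

theorem IsComponent.nonneg (h : IsComponent H ρ) (t : ℝ) : 0 ≤ ρ t := by
  rw [← h.zero]; exact h.le_of_abs_le (by simp)

theorem IsComponent.continuous (h : IsComponent H ρ) : Continuous ρ := by
  have hpos : ∀ x, 0 ≤ x → ContinuousAt ρ x := fun x hx => by
    rcases hx.eq_or_lt with rfl | hx
    · exact h.cont
    · exact (h.diff x hx).continuousAt
  have : ρ = fun t => ρ |t| := funext fun t => (h.apply_abs t).symm
  rw [this, continuous_iff_continuousAt]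
  exact fun x => ContinuousAt.comp (f := fun t => |t|) (hpos _ (abs_nonneg x))
    continuous_abs.continuousAt

theorem IsComponent.sub_le (h : IsComponent H ρ) {C x y : ℝ} (hx : 0 ≤ x) (hxy : x ≤ y)
    (hC : ∀ t ∈ Set.Ioo x y, deriv ρ t ≤ C) : ρ y - ρ x ≤ C * (y - x) := by
  refine (convex_Icc x y).image_sub_le_mul_sub_of_deriv_le h.continuous.continuousOn ?_ ?_ x
    (Set.left_mem_Icc.2 hxy) y (Set.right_mem_Icc.2 hxy) hxy
  · rw [interior_Icc]
    exact fun t ht => (h.diff t (hx.trans_lt ht.1)).differentiableWithinAt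
  · rwa [interior_Icc]

theorem IsComponent.le_sub (h : IsComponent H ρ) {C x y : ℝ} (hx : 0 ≤ x) (hxy : x ≤ y)
    (hC : ∀ t ∈ Set.Ioo x y, C ≤ deriv ρ t) : C * (y - x) ≤ ρ y - ρ x := by
  refine (convex_Icc x y).mul_sub_le_image_sub_of_le_deriv h.continuous.continuousOn ?_ ?_ x
    (Set.left_mem_Icc.2 hxy) y (Set.right_mem_Icc.2 hxy) hxy
  · rw [interior_Icc]
    exact fun t ht => (h.diff t (hx.trans_lt ht.1)).differentiableWithinAt
  · rwa [interior_Icc]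

/-- The Lipschitz derivative cannot blow up at `0`, although `ρ` may have a kink there. This makes
the suprema in `exists_steep_or_flat` finite. -/
theorem IsComponent.bddAbove_deriv (h : IsComponent H ρ) {a : ℝ} (ha : 0 < a) :
    BddAbove (deriv ρ '' Set.Ioc 0 a) := by
  refine ⟨deriv ρ a + |H| * a, ?_⟩
  rintro _ ⟨x, hx, rfl⟩
  have h1 := (abs_le.1 (h.lip x a hx.1 ha)).2
  have h2 : H * |x - a| ≤ |H| * a := by
    refine mul_le_mul (le_abs_self H) ?_ (abs_nonneg _) (abs_nonneg _)
    rw [abs_le]; constructor <;> linarith [hx.1, hx.2]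
  linarith

theorem IsRegularizer.continuous {d : ℕ} {reg : EuclideanSpace ℝ (Fin d) → ℝ}
    (h : IsRegularizer H reg) : Continuous reg := by
  obtain ⟨ρ, hreg, hρ⟩ := h
  rw [funext hreg]
  refine continuous_finsetSum _ fun j _ => (hρ j).continuous.comp ?_
  fun_prop

theorem continuous_apply {n d : ℕ} (X : Matrix (Fin n) (Fin d) ℝ) :
    Continuous (apply X) := by
  unfold apply
  exact (PiLp.continuous_toLp 2 _).comp
    (Continuous.matrix_mulVec continuous_const (PiLp.continuous_ofLp 2 _))

theorem IsRegularizer.continuous_loss {n d : ℕ} {reg : EuclideanSpace ℝ (Fin d) → ℝ}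
    (h : IsRegularizer H reg) (X : Matrix (Fin n) (Fin d) ℝ) (y : EuclideanSpace ℝ (Fin n))
    (lam : ℝ) : Continuous (loss X reg y lam) := by
  unfold loss
  have h1 := h.continuous
  have h2 := continuous_apply X
  fun_prop

end Component

end LocalDescent

namespace LocalDescent

/-! ### The block design, its pairwise decomposition of the cost, and boundedness of runs. -/

section Design

/-- The index of coordinate `s` of the `i`-th pair of consecutive coordinates. -/
def pairIdx {b m : ℕ} (h : 2 * b ≤ m) (i : Fin b) (s : Bool) : Fin m :=
  ⟨2 * i + s.toNat, by have := i.2; cases s <;> simp <;> omega⟩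

theorem pairIdx_inj {b m : ℕ} (h : 2 * b ≤ m) {i i' : Fin b} {s s' : Bool}
    (he : pairIdx h i s = pairIdx h i' s') : i = i' ∧ s = s' := by
  have := congrArg Fin.val he
  cases s <;> cases s' <;> simp [pairIdx, Fin.ext_iff] at * <;> omega

theorem exists_pairIdx_eq {b m : ℕ} (h : 2 * b ≤ m) {j : Fin m} (hj : j.val / 2 < b) :
    ∃ i s, pairIdx h i s = j := by
  rcases Nat.mod_two_eq_zero_or_one j.val with h' | h'
  · exact ⟨⟨j.val / 2, hj⟩, false, by simp [pairIdx, Fin.ext_iff]; omega⟩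
  · exact ⟨⟨j.val / 2, hj⟩, true, by simp [pairIdx, Fin.ext_iff]; omega⟩

/-- The block-diagonal design with `b` blocks `√n * [[1/2, -1/2], [u, u]]` and zeros elsewhere. -/
noncomputable def pairDesign (n d b : ℕ) (u : ℝ) : Matrix (Fin n) (Fin d) ℝ := fun r c =>
  if r.val / 2 = c.val / 2 ∧ r.val / 2 < b then
    √(n : ℝ) * (if r.val % 2 = 0 then (if c.val % 2 = 0 then 1 / 2 else -(1 / 2)) else u)
  else 0

variable {n d b : ℕ} (hn : 2 * b ≤ n) (hd : 2 * b ≤ d) (u : ℝ)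

include hd in
theorem pairDesign_apply_false (θ : EuclideanSpace ℝ (Fin d)) (i : Fin b) :
    apply (pairDesign n d b u) θ (pairIdx hn i false) =
      √(n : ℝ) * ((θ (pairIdx hd i false) - θ (pairIdx hd i true)) / 2) := by
  have hi := i.2
  change ∑ c, pairDesign n d b u (pairIdx hn i false) c * θ c = _
  rw [Fintype.sum_eq_add (pairIdx hd i false) (pairIdx hd i true)]
  · have e : (2 * i.val + 1) / 2 = i.val := by omega
    have e' : (2 * i.val + 1) % 2 = 1 := by omega
    simp [pairDesign, pairIdx, e, e']
    ring
  · intro h; simpa using (pairIdx_inj hd h).2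
  · rintro c ⟨h1, h2⟩
    have : ¬ (i.val = c.val / 2) := by
      intro h
      rw [Ne, Fin.ext_iff] at h1 h2
      simp [pairIdx] at h1 h2
      omega
    simp [pairDesign, pairIdx, this]

include hd in
theorem pairDesign_apply_true (θ : EuclideanSpace ℝ (Fin d)) (i : Fin b) :
    apply (pairDesign n d b u) θ (pairIdx hn i true) =
      √(n : ℝ) * (u * (θ (pairIdx hd i false) + θ (pairIdx hd i true))) := by
  have hi := i.2
  have e : (2 * i.val + 1) / 2 = i.val := by omega
  have e' : (2 * i.val + 1) % 2 = 1 := by omega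
  change ∑ c, pairDesign n d b u (pairIdx hn i true) c * θ c = _
  rw [Fintype.sum_eq_add (pairIdx hd i false) (pairIdx hd i true)]
  · simp [pairDesign, pairIdx, e, e']
    ring
  · intro h; simpa using (pairIdx_inj hd h).2
  · rintro c ⟨h1, h2⟩
    have : ¬ (i.val = c.val / 2) := by
      intro h
      rw [Ne, Fin.ext_iff] at h1 h2
      simp [pairIdx] at h1 h2
      omega
    simp [pairDesign, pairIdx, e, this]

theorem pairDesign_apply_of_le (θ : EuclideanSpace ℝ (Fin d)) {r : Fin n} (hr : b ≤ r.val / 2) :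
    apply (pairDesign n d b u) θ r = 0 := by
  change ∑ c, pairDesign n d b u r c * θ c = _
  refine Finset.sum_eq_zero fun c _ => ?_
  simp [pairDesign, not_lt.2 hr]

include hn hd in
theorem columnNormalized_pairDesign (hn0 : 0 < n) (hu : u ^ 2 ≤ 1 / 4) :
    ColumnNormalized (pairDesign n d b u) := by
  have hn' : (0 : ℝ) < n := by exact_mod_cast hn0
  intro j
  rw [div_le_one (by positivity), EuclideanSpace.norm_eq]
  apply Real.sqrt_le_sqrt
  by_cases hj : j.val / 2 < b
  · obtain ⟨i, s, rfl⟩ := exists_pairIdx_eq hd hj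
    have hi := i.2
    rw [Fintype.sum_eq_add (pairIdx hn i false) (pairIdx hn i true)]
    · have e : (2 * i.val + 1) / 2 = i.val := by omega
      have e' : (2 * i.val + 1) % 2 = 1 := by omega
      cases s <;> simp [pairDesign, pairIdx, e, e', mul_pow] <;> nlinarith
    · intro h; simpa using (pairIdx_inj hn h).2
    · rintro c ⟨h1, h2⟩
      have : ¬ (c.val / 2 = (pairIdx hd i s).val / 2) := by
        intro h
        rw [Ne, Fin.ext_iff] at h1 h2
        cases s <;> simp [pairIdx] at h h1 h2 <;> omega
      simp only [pairDesign, this, false_and, if_false]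
      simp
  · rw [Finset.sum_eq_zero]
    · exact hn'.le
    · intro r _
      have : ¬ (r.val / 2 = j.val / 2 ∧ r.val / 2 < b) := fun h => hj (h.1 ▸ h.2)
      simp only [pairDesign, this, if_false]
      simp

/-- The contribution of the `i`-th pair of rows to the least-squares cost. -/
noncomputable def pairFit (y : EuclideanSpace ℝ (Fin n)) (i : Fin b) (θ : EuclideanSpace ℝ (Fin d)) : ℝ :=
  (y (pairIdx hn i false) / √(n : ℝ) - (θ (pairIdx hd i false) - θ (pairIdx hd i true)) / 2) ^ 2 +
    (y (pairIdx hn i true) / √(n : ℝ) - u * (θ (pairIdx hd i false) + θ (pairIdx hd i true))) ^ 2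

theorem apply_sub (X : Matrix (Fin n) (Fin d) ℝ) (θ θ' : EuclideanSpace ℝ (Fin d)) :
    apply X (θ - θ') = apply X θ - apply X θ' := by
  simp [apply, Matrix.mulVec_sub]

variable {u}

theorem pairFit_eq (hn0 : 0 < n) (y : EuclideanSpace ℝ (Fin n)) (i : Fin b)
    (θ : EuclideanSpace ℝ (Fin d)) :
    pairFit hn hd u y i θ = 1 / (n : ℝ) *
      ((y - apply (pairDesign n d b u) θ) (pairIdx hn i false) ^ 2 +
        (y - apply (pairDesign n d b u) θ) (pairIdx hn i true) ^ 2) := by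
  have hn' : (0 : ℝ) < n := by exact_mod_cast hn0
  have hs : √(n : ℝ) ^ 2 = n := Real.sq_sqrt hn'.le
  have hs0 : 0 < √(n : ℝ) := Real.sqrt_pos.2 hn'
  have key : ∀ a t : ℝ, (a / √(n : ℝ) - t) ^ 2 = 1 / (n : ℝ) * (a - √(n : ℝ) * t) ^ 2 := by
    intro a t
    rw [show a - √(n : ℝ) * t = √(n : ℝ) * (a / √(n : ℝ) - t) by field_simp, mul_pow, hs]
    field_simp
  rw [PiLp.sub_apply, PiLp.sub_apply, pairDesign_apply_false hn hd, pairDesign_apply_true hn hd,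
    pairFit, key, key]
  ring

theorem pairFit_nonneg (y : EuclideanSpace ℝ (Fin n)) (i : Fin b)
    (θ : EuclideanSpace ℝ (Fin d)) : 0 ≤ pairFit hn hd u y i θ := by
  unfold pairFit; positivity

/-- Distinct pairs occupy disjoint rows; the rows left out contribute nonnegative squares. -/
theorem sum_pairFit_le (hn0 : 0 < n) (y : EuclideanSpace ℝ (Fin n)) (S : Finset (Fin b))
    (θ : EuclideanSpace ℝ (Fin d)) :
    ∑ i ∈ S, pairFit hn hd u y i θ ≤
      1 / (n : ℝ) * ‖y - apply (pairDesign n d b u) θ‖ ^ 2 := by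
  rw [EuclideanSpace.norm_sq_eq]
  simp only [pairFit_eq hn hd hn0, Real.norm_eq_abs, sq_abs]
  rw [← Finset.mul_sum]
  refine mul_le_mul_of_nonneg_left ?_ (by positivity)
  set f : Fin n → ℝ := fun r => (y - apply (pairDesign n d b u) θ) r ^ 2
  have h1 : ∑ i ∈ S, (f (pairIdx hn i false) + f (pairIdx hn i true)) =
      ∑ p ∈ S ×ˢ (Finset.univ : Finset Bool), f (pairIdx hn p.1 p.2) := by
    rw [Finset.sum_product]
    refine Finset.sum_congr rfl fun i _ => ?_
    simp [add_comm]
  refine h1.trans_le ?_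
  rw [← Finset.sum_image (f := f) (g := fun p : Fin b × Bool => pairIdx hn p.1 p.2)]
  · exact Finset.sum_le_sum_of_subset_of_nonneg (Finset.subset_univ _)
      fun r _ _ => sq_nonneg _
  · rintro ⟨i, s⟩ - ⟨i', s'⟩ - h
    obtain ⟨rfl, rfl⟩ := pairIdx_inj hn h
    rfl

theorem pairFit_zero_apply (i : Fin b) (θ : EuclideanSpace ℝ (Fin d)) :
    pairFit hn hd u 0 i θ =
      ((θ (pairIdx hd i false) - θ (pairIdx hd i true)) / 2) ^ 2 +
        (u * (θ (pairIdx hd i false) + θ (pairIdx hd i true))) ^ 2 := by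
  simp [pairFit]

theorem sum_pairFit_le_predErr (hn0 : 0 < n) (S : Finset (Fin b))
    (θ θ' : EuclideanSpace ℝ (Fin d)) :
    ∑ i ∈ S, pairFit hn hd u 0 i (θ - θ') ≤ predErr (pairDesign n d b u) θ θ' := by
  refine (sum_pairFit_le hn hd hn0 0 S (θ - θ')).trans_eq ?_
  rw [predErr, apply_sub, zero_sub, norm_neg]

variable {H lam : ℝ} {reg : EuclideanSpace ℝ (Fin d) → ℝ} {ρ : Fin d → ℝ → ℝ}

/-- The change of the cost when only one pair of coordinates is changed. -/
theorem loss_sub_loss (hn0 : 0 < n) (hreg : ∀ θ, reg θ = ∑ j, ρ j (θ j))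
    (y : EuclideanSpace ℝ (Fin n)) (i : Fin b) {θ θ' : EuclideanSpace ℝ (Fin d)}
    (h : ∀ j, j ≠ pairIdx hd i false → j ≠ pairIdx hd i true → θ j = θ' j) :
    loss (pairDesign n d b u) reg y lam θ - loss (pairDesign n d b u) reg y lam θ' =
      pairFit hn hd u y i θ - pairFit hn hd u y i θ' +
        lam * ((ρ (pairIdx hd i false) (θ (pairIdx hd i false)) -
            ρ (pairIdx hd i false) (θ' (pairIdx hd i false))) +
          (ρ (pairIdx hd i true) (θ (pairIdx hd i true)) -
            ρ (pairIdx hd i true) (θ' (pairIdx hd i true)))) := by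
  have hreg' : reg θ - reg θ' = (ρ (pairIdx hd i false) (θ (pairIdx hd i false)) -
            ρ (pairIdx hd i false) (θ' (pairIdx hd i false))) +
          (ρ (pairIdx hd i true) (θ (pairIdx hd i true)) -
            ρ (pairIdx hd i true) (θ' (pairIdx hd i true))) := by
    rw [hreg, hreg, ← Finset.sum_sub_distrib]
    refine Fintype.sum_eq_add _ _ (fun h => by simpa using (pairIdx_inj hd h).2) ?_
    rintro j ⟨h1, h2⟩
    rw [h j h1 h2, sub_self]
  have hfit : ‖y - apply (pairDesign n d b u) θ‖ ^ 2 - ‖y - apply (pairDesign n d b u) θ'‖ ^ 2 =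
      ((y - apply (pairDesign n d b u) θ) (pairIdx hn i false) ^ 2 -
        (y - apply (pairDesign n d b u) θ') (pairIdx hn i false) ^ 2) +
      ((y - apply (pairDesign n d b u) θ) (pairIdx hn i true) ^ 2 -
        (y - apply (pairDesign n d b u) θ') (pairIdx hn i true) ^ 2) := by
    rw [EuclideanSpace.norm_sq_eq, EuclideanSpace.norm_sq_eq, ← Finset.sum_sub_distrib]
    simp only [Real.norm_eq_abs, sq_abs]
    refine Fintype.sum_eq_add _ _ (fun h => by simpa using (pairIdx_inj hn h).2) ?_
    rintro r ⟨h1, h2⟩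
    have : apply (pairDesign n d b u) θ r = apply (pairDesign n d b u) θ' r := by
      rcases lt_or_ge (r.val / 2) b with hr | hr
      · obtain ⟨i', s, rfl⟩ := exists_pairIdx_eq hn hr
        have hne : i' ≠ i := by
          rintro rfl
          cases s
          exacts [h1 rfl, h2 rfl]
        have hc : ∀ s, θ (pairIdx hd i' s) = θ' (pairIdx hd i' s) := fun s =>
          h _ (fun e => hne (pairIdx_inj hd e).1) (fun e => hne (pairIdx_inj hd e).1)
        cases s
        · rw [pairDesign_apply_false hn hd, pairDesign_apply_false hn hd, hc, hc]
        · rw [pairDesign_apply_true hn hd, pairDesign_apply_true hn hd, hc, hc]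
      · rw [pairDesign_apply_of_le u θ hr, pairDesign_apply_of_le u θ' hr]
    rw [PiLp.sub_apply, PiLp.sub_apply, this, sub_self]
  rw [pairFit_eq hn hd hn0, pairFit_eq hn hd hn0, ← hreg', loss, loss]
  linear_combination (1 / (n : ℝ)) * hfit

/-- On coordinates unseen by the design, a step never increases the absolute value. -/
theorem IsStep.abs_le_abs (hreg : ∀ θ, reg θ = ∑ j, ρ j (θ j)) (hρ : ∀ j, IsComponent H (ρ j))
    (hlam : 0 ≤ lam) {y : EuclideanSpace ℝ (Fin n)} {η : ℝ} {x z : EuclideanSpace ℝ (Fin d)}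
    (h : IsStep (loss (pairDesign n d b u) reg y lam) η x z) {j : Fin d} (hj : b ≤ j.val / 2) :
    |z j| ≤ |x j| := by
  by_contra! hlt
  -- Undoing the move of coordinate `j` leaves the fit unchanged, does not raise the penalty, and is
  -- strictly closer to `x`, against the tie-breaking rule.
  set z' : EuclideanSpace ℝ (Fin d) := WithLp.toLp 2 (Function.update (WithLp.ofLp z) j (x j))
    with hz'
  have hz'j : z' j = x j := by simp [hz']
  have hz'n : ∀ c, c ≠ j → z' c = z c := fun c hc => by simp [hz', hc]
  have happ : apply (pairDesign n d b u) z' = apply (pairDesign n d b u) z := by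
    ext r
    change ∑ c, pairDesign n d b u r c * z' c = ∑ c, pairDesign n d b u r c * z c
    refine Finset.sum_congr rfl fun c _ => ?_
    rcases eq_or_ne c j with rfl | hc
    · have : ¬ (r.val / 2 = c.val / 2 ∧ r.val / 2 < b) := fun h => by omega
      simp [pairDesign, this]
    · rw [hz'n c hc]
  have hL : loss (pairDesign n d b u) reg y lam z' ≤ loss (pairDesign n d b u) reg y lam z := by
    rw [loss, loss, happ, hreg, hreg]
    gcongr with c
    rcases eq_or_ne c j with rfl | hc
    · rw [hz'j]; exact (hρ _).le_of_abs_le hlt.le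
    · rw [hz'n c hc]
  have hdist : dist z' x < dist z x := by
    rw [EuclideanSpace.dist_eq, EuclideanSpace.dist_eq]
    refine Real.sqrt_lt_sqrt (Finset.sum_nonneg fun c _ => sq_nonneg _) ?_
    refine Finset.sum_lt_sum (fun c _ => ?_) ⟨j, Finset.mem_univ _, ?_⟩
    · rcases eq_or_ne c j with rfl | hc
      · rw [hz'j, dist_self, zero_pow two_ne_zero]; exact sq_nonneg _
      · rw [hz'n c hc]
    · have : 0 < dist (z j) (x j) := dist_pos.2 fun e => by rw [e] at hlt; exact lt_irrefl _ hlt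
      rw [hz'j, dist_self, zero_pow two_ne_zero]; positivity
  exact absurd (h.2 z' ⟨hdist.le.trans h.1.1, fun a ha => hL.trans (h.1.2 a ha)⟩) (not_le.2 hdist)

include hn hd in
/-- Every run of the method is bounded. -/
theorem isBounded_run (hn0 : 0 < n) (hu : 0 < u) (hreg : ∀ θ, reg θ = ∑ j, ρ j (θ j))
    (hρ : ∀ j, IsComponent H (ρ j)) (hlam : 0 ≤ lam) {y : EuclideanSpace ℝ (Fin n)} {η : ℝ}
    (hη : 0 ≤ η) {θ : ℕ → EuclideanSpace ℝ (Fin d)}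
    (hstep : ∀ t, IsStep (loss (pairDesign n d b u) reg y lam) η (θ t) (θ (t + 1))) :
    Bornology.IsBounded (Set.range θ) := by
  set L := loss (pairDesign n d b u) reg y lam with hLdef
  have hanti : Antitone fun t => L (θ t) := antitone_nat_of_succ_le fun t => (hstep t).le hη
  have hfit : ∀ t i, pairFit hn hd u y i (θ t) ≤ L (θ 0) := fun t i => by
    have h1 := sum_pairFit_le hn hd (u := u) hn0 y {i} (θ t)
    rw [Finset.sum_singleton] at h1
    have h2 : 0 ≤ lam * reg (θ t) := by
      rw [hreg]; exact mul_nonneg hlam (Finset.sum_nonneg fun j _ => (hρ j).nonneg _)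
    have h3 : L (θ t) ≤ L (θ 0) := hanti (Nat.zero_le t)
    have h4 : L (θ t) = 1 / (n : ℝ) * ‖y - apply (pairDesign n d b u) (θ t)‖ ^ 2 +
      lam * reg (θ t) := rfl
    linarith
  have hcoord : ∀ j, ∃ M, ∀ t, |θ t j| ≤ M := by
    intro j
    rcases lt_or_ge (j.val / 2) b with hj | hj
    · obtain ⟨i, s, rfl⟩ := exists_pairIdx_eq hd hj
      set a := y (pairIdx hn i false) / √(n : ℝ)
      set c := y (pairIdx hn i true) / √(n : ℝ)
      set K := √(L (θ 0))
      -- The cost never rises, so the two rows of the block bound `p - q` and, as `u > 0`, `p + q`.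
      refine ⟨(|a| + K) + (|c| + K) / u, fun t => ?_⟩
      have h := hfit t i
      rw [pairFit] at h
      set p := θ t (pairIdx hd i false)
      set q := θ t (pairIdx hd i true)
      have h1 : |a - (p - q) / 2| ≤ K := Real.abs_le_sqrt (by nlinarith [sq_nonneg (c - u * (p + q))])
      have h2 : |c - u * (p + q)| ≤ K := Real.abs_le_sqrt (by nlinarith [sq_nonneg (a - (p - q) / 2)])
      have h3 : |(p - q) / 2| ≤ |a| + K := by
        have := abs_sub_abs_le_abs_sub ((p - q) / 2) a
        rw [abs_sub_comm] at this; linarith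
      have h4 : |p + q| ≤ (|c| + K) / u := by
        rw [le_div_iff₀ hu]
        have := abs_sub_abs_le_abs_sub (u * (p + q)) c
        rw [abs_sub_comm, abs_mul, abs_of_pos hu] at this
        nlinarith
      have h5 := abs_le.1 h3
      have h6 := abs_le.1 h4
      cases s
      · change |p| ≤ _
        rw [abs_le]; constructor <;> linarith
      · change |q| ≤ _
        rw [abs_le]; constructor <;> linarith
    · refine ⟨|θ 0 j|, fun t => ?_⟩
      induction t with
      | zero => rfl
      | succ t ih => exact ((hstep t).abs_le_abs hreg hρ hlam hj).trans ih
  choose M hM using hcoord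
  rw [isBounded_iff_forall_norm_le]
  refine ⟨√(∑ j, M j ^ 2), ?_⟩
  rintro _ ⟨t, rfl⟩
  rw [EuclideanSpace.norm_eq]
  refine Real.sqrt_le_sqrt (Finset.sum_le_sum fun j _ => ?_)
  rw [Real.norm_eq_abs]
  exact pow_le_pow_left₀ (abs_nonneg _) (hM j t) 2

end Design

end LocalDescent

namespace LocalDescent

/-! ### The two mechanisms: barriers at steep penalties, escape from zero at flat ones. -/

section LowerBounds

variable {n d b : ℕ} (hn : 2 * b ≤ n) (hd : 2 * b ≤ d) {u τ : ℝ}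
  {H lam : ℝ} {reg : EuclideanSpace ℝ (Fin d) → ℝ} {ρ : Fin d → ℝ → ℝ}

/-- If the penalty of both coordinates of a pair is steep at `x s ∈ (0, τ/4]`, then the iterates
cannot cross these points from below. -/
theorem IsStep.le_of_steep (hn0 : 0 < n) (hu : u ^ 2 ≤ 1 / 4) (hτ : 0 < τ)
    (hreg : ∀ θ, reg θ = ∑ j, ρ j (θ j)) (hρ : ∀ j, IsComponent H (ρ j)) (hlam : 0 ≤ lam)
    {y : EuclideanSpace ℝ (Fin n)} {i : Fin b} {η : ℝ} (hη : η * (lam * H) ≤ τ / 4)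
    (hy0 : |y (pairIdx hn i false) / √(n : ℝ)| ≤ τ)
    (hy1 : u * (y (pairIdx hn i true) / √(n : ℝ)) ≤ 3 / 4 * τ)
    {x : Bool → ℝ} (hx0 : ∀ s, 0 < x s) (hxτ : ∀ s, x s ≤ τ / 4)
    (hx : ∀ s, 3 * τ ≤ lam * deriv (ρ (pairIdx hd i s)) (x s))
    {θ z : EuclideanSpace ℝ (Fin d)} (h : IsStep (loss (pairDesign n d b u) reg y lam) η θ z)
    (hθ : ∀ s, θ (pairIdx hd i s) ≤ x s) (s : Bool) : z (pairIdx hd i s) ≤ x s := by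
  have hH : 0 ≤ H := by
    have := (hρ (pairIdx hd i s)).lip 1 2 one_pos two_pos
    have h' := abs_nonneg (deriv (ρ (pairIdx hd i s)) 1 - deriv (ρ (pairIdx hd i s)) 2)
    norm_num at this
    linarith
  have hdist : dist z θ ≤ η := h.1.1
  have hcoord : ∀ j, |z j - θ j| ≤ η := fun j => by
    have h1 := PiLp.norm_apply_le (p := 2) (z - θ) j
    rw [← dist_eq_norm] at h1
    exact h1.trans hdist
  -- The competitor cuts `z` back to the barrier on the pair; it stays in the ball because `θ` lies
  -- below the barrier.
  set z' : EuclideanSpace ℝ (Fin d) := WithLp.toLp 2 (fun j =>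
    if j = pairIdx hd i false then min (z j) (x false)
    else if j = pairIdx hd i true then min (z j) (x true) else z j) with hz'
  have hne : pairIdx hd i true ≠ pairIdx hd i false := fun h => by
    simpa using (pairIdx_inj hd h).2
  have hz's : ∀ s, z' (pairIdx hd i s) = min (z (pairIdx hd i s)) (x s) := by
    intro s; cases s <;> simp [hz', hne]
  have hz'n : ∀ j, j ≠ pairIdx hd i false → j ≠ pairIdx hd i true → z j = z' j :=
    fun j h1 h2 => by simp [hz', h1, h2]
  have hz'mem : z' ∈ Metric.closedBall θ η := by
    refine le_trans ?_ hdist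
    rw [EuclideanSpace.dist_eq, EuclideanSpace.dist_eq]
    refine Real.sqrt_le_sqrt (Finset.sum_le_sum fun j _ => ?_)
    refine pow_le_pow_left₀ dist_nonneg ?_ 2
    rw [Real.dist_eq, Real.dist_eq]
    have aux : ∀ a c t : ℝ, t ≤ c → |min a c - t| ≤ |a - t| := by
      intro a c t htc
      rcases le_total a c with hac | hac
      · rw [min_eq_left hac]
      · rw [min_eq_right hac, abs_of_nonneg (by linarith), abs_of_nonneg (by linarith)]
        linarith
    by_cases h1 : j = pairIdx hd i false
    · subst h1; rw [hz's]; exact aux _ _ _ (hθ _)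
    by_cases h2 : j = pairIdx hd i true
    · subst h2; rw [hz's]; exact aux _ _ _ (hθ _)
    rw [hz'n j h1 h2]
  have hle := h.1.2 z' hz'mem
  have hdiff := loss_sub_loss (u := u) (lam := lam) hn hd hn0 hreg y i hz'n
  have hpen : ∀ s, (11 / 4 * τ) * (z (pairIdx hd i s) - z' (pairIdx hd i s)) ≤
      lam * (ρ (pairIdx hd i s) (z (pairIdx hd i s)) -
        ρ (pairIdx hd i s) (z' (pairIdx hd i s))) := by
    intro s
    rw [hz's]
    rcases le_total (z (pairIdx hd i s)) (x s) with hc | hc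
    · rw [min_eq_left hc]; simp
    · rw [min_eq_right hc]
      have h1 := (hρ (pairIdx hd i s)).le_sub
        (C := deriv (ρ (pairIdx hd i s)) (x s) - H * η) (hx0 s).le hc (fun t ht => by
          have h2 := (abs_le.1 ((hρ (pairIdx hd i s)).lip t (x s) ((hx0 s).trans ht.1) (hx0 s))).1
          have h3 : |t - x s| ≤ η := by
            rw [abs_of_pos (by linarith [ht.1])]
            have := (abs_le.1 (hcoord (pairIdx hd i s))).2
            linarith [ht.2, hθ s]
          nlinarith)
      -- Slope `3 * τ` at the barrier, less the variation `lam * H * η ≤ τ / 4` within one step.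
      have h2 : 11 / 4 * τ ≤ lam * (deriv (ρ (pairIdx hd i s)) (x s) - H * η) := by
        nlinarith [hx s]
      calc _ ≤ lam * (deriv (ρ (pairIdx hd i s)) (x s) - H * η) * (z (pairIdx hd i s) - x s) :=
            mul_le_mul_of_nonneg_right h2 (by linarith)
        _ ≤ _ := by rw [mul_assoc]; exact mul_le_mul_of_nonneg_left h1 hlam
  have hp0 := hpen false
  have hp1 := hpen true
  have hδ0 : 0 ≤ z (pairIdx hd i false) - z' (pairIdx hd i false) := by
    rw [hz's]; linarith [min_le_left (z (pairIdx hd i false)) (x false)]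
  have hδ1 : 0 ≤ z (pairIdx hd i true) - z' (pairIdx hd i true) := by
    rw [hz's]; linarith [min_le_left (z (pairIdx hd i true)) (x true)]
  have hz'le : ∀ s, z' (pairIdx hd i s) ≤ τ / 4 := fun s => by
    rw [hz's]; exact (min_le_right _ _).trans (hxτ s)
  have hz'pos : ∀ s, z (pairIdx hd i s) - z' (pairIdx hd i s) = 0 ∨ 0 < z' (pairIdx hd i s) := by
    intro s
    rw [hz's]
    rcases le_total (z (pairIdx hd i s)) (x s) with hc | hc
    · left; rw [min_eq_left hc, sub_self]
    · right; rw [min_eq_right hc]; exact hx0 s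
  have hq0 := hz'pos false
  have hq1 := hz'pos true
  have hl0 := hz'le false
  have hl1 := hz'le true
  rw [pairFit, pairFit] at hdiff
  obtain ⟨ha1, ha2⟩ := abs_le.1 hy0
  set a := y (pairIdx hn i false) / √(n : ℝ)
  set c := y (pairIdx hn i true) / √(n : ℝ)
  set p := z' (pairIdx hd i false)
  set q := z' (pairIdx hd i true)
  set δ := z (pairIdx hd i false) - p with hδ
  set ε := z (pairIdx hd i true) - q with hε
  have e0 : z (pairIdx hd i false) = p + δ := by rw [hδ]; ring
  have e1 : z (pairIdx hd i true) = q + ε := by rw [hε]; ring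
  have hu0 : 0 ≤ u ^ 2 := sq_nonneg u
  -- Here `21/8 = 1 + 3/2 + 1/8`, from `a`, `2 * u * c` and the partner `q`. Since `u ^ 2 ≤ 1 / 4`,
  -- the coefficient `2 * u ^ 2 - 1 / 2` of `q` is nonpositive, so `q ≤ τ / 4` suffices however
  -- negative `q` is.
  have hg0 : -(21 / 8 * τ) * δ ≤ (-(a - (p - q) / 2) - 2 * u * (c - u * (p + q))) * δ := by
    rcases hq0 with h0 | h0
    · rw [h0]; simp
    · refine mul_le_mul_of_nonneg_right ?_ hδ0
      linarith [mul_nonneg hu0 h0.le, mul_nonneg (sub_nonneg.2 hu) (sub_nonneg.2 hl1),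
        mul_nonneg hu0 hτ.le]
  have hg1 : -(21 / 8 * τ) * ε ≤ ((a - (p - q) / 2) - 2 * u * (c - u * (p + q))) * ε := by
    rcases hq1 with h0 | h0
    · rw [h0]; simp
    · refine mul_le_mul_of_nonneg_right ?_ hδ1
      linarith [mul_nonneg hu0 h0.le, mul_nonneg (sub_nonneg.2 hu) (sub_nonneg.2 hl0),
        mul_nonneg hu0 hτ.le]
  have hquad : (a - (z (pairIdx hd i false) - z (pairIdx hd i true)) / 2) ^ 2 +
      (c - u * (z (pairIdx hd i false) + z (pairIdx hd i true))) ^ 2 -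
      ((a - (p - q) / 2) ^ 2 + (c - u * (p + q)) ^ 2) =
      (-(a - (p - q) / 2) - 2 * u * (c - u * (p + q))) * δ +
      ((a - (p - q) / 2) - 2 * u * (c - u * (p + q))) * ε + ((δ - ε) / 2) ^ 2 +
        (u * (δ + ε)) ^ 2 := by
    rw [e0, e1]; ring
  -- The margin is `11/4 - 21/8 = 1/8`: crossing the barrier would cost more than it gains.
  have hsum : τ / 8 * (δ + ε) ≤ 0 := by
    linarith [sq_nonneg ((δ - ε) / 2), sq_nonneg (u * (δ + ε))]
  have hsum' : δ + ε ≤ 0 := by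
    by_contra! hpos
    have : 0 < τ / 8 * (δ + ε) := by positivity
    linarith
  have hs0 : z (pairIdx hd i s) - z' (pairIdx hd i s) ≤ 0 := by
    cases s
    · change δ ≤ 0; linarith
    · change ε ≤ 0; linarith
  have := (hz's s).trans_le (min_le_right _ _)
  linarith

/-- If the penalty of one coordinate of a pair is flat on `(0, τ/4)` and the data pull this
coordinate strongly to the right, then no local minimum has both coordinates near zero. -/
theorem exists_le_abs_of_flat (hn0 : 0 < n) (hu0 : 0 ≤ u) (hu : u ^ 2 ≤ 1 / 4) (hτ : 0 < τ)
    (hreg : ∀ θ, reg θ = ∑ j, ρ j (θ j)) (hρ : ∀ j, IsComponent H (ρ j)) (hlam : 0 ≤ lam)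
    {y : EuclideanSpace ℝ (Fin n)} {i : Fin b} {s : Bool}
    (hflat : ∀ t ∈ Set.Ioo 0 (τ / 4), lam * deriv (ρ (pairIdx hd i s)) t ≤ 3 * τ)
    (hy0 : 4 * τ ≤ (if s then -1 else 1) * (y (pairIdx hn i false) / √(n : ℝ)))
    (hy1 : 0 ≤ y (pairIdx hn i true) / √(n : ℝ))
    {θ : EuclideanSpace ℝ (Fin d)}
    (hmin : IsLocalMin (loss (pairDesign n d b u) reg y lam) θ) :
    ∃ s', τ / 4 ≤ |θ (pairIdx hd i s')| := by
  by_contra! hlt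
  set L := loss (pairDesign n d b u) reg y lam with hL
  set j := pairIdx hd i s with hj
  have hcont : Continuous fun t : ℝ => θ + t • EuclideanSpace.single j (1 : ℝ) := by fun_prop
  have htend : Filter.Tendsto (fun t : ℝ => θ + t • EuclideanSpace.single j (1 : ℝ))
      (nhdsWithin 0 (Set.Ioi 0)) (nhds θ) := by
    have := hcont.tendsto 0
    simp only [zero_smul, add_zero] at this
    exact this.mono_left nhdsWithin_le_nhds
  -- A small move to the right stays on one side of `0`: from a negative value it does not raise the
  -- penalty, otherwise it stays in the flat range.
  have hgap : 0 < if θ j < 0 then -θ j else τ / 4 - θ j := by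
    have := (abs_lt.1 (hlt s)).2
    split_ifs with h
    · linarith
    · exact sub_pos.2 this
  have hsmall := Ioo_mem_nhdsGT (show (0 : ℝ) < min (τ / 4)
    (if θ j < 0 then -θ j else τ / 4 - θ j) from lt_min (by linarith) hgap)
  obtain ⟨t, hle, ht0, ht⟩ := ((htend.eventually hmin).and hsmall).exists
  have ht1 := ht.trans_le (min_le_left _ _)
  have ht2 := ht.trans_le (min_le_right _ _)
  set θ' := θ + t • EuclideanSpace.single j (1 : ℝ) with hθ'
  have hθ'j : θ' j = θ j + t := by simp [hθ']
  have hθ'n : ∀ c, c ≠ j → θ' c = θ c := fun c hc => by simp [hθ', hc]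
  have hother : pairIdx hd i (!s) ≠ j := fun e => by
    have := (pairIdx_inj hd e).2
    cases s <;> simp at this
  have hdiff := loss_sub_loss (u := u) (lam := lam) (θ := θ') (θ' := θ) hn hd hn0 hreg y i
    (fun c h1 h2 => hθ'n c (by cases s <;> assumption))
  have hpen : lam * (ρ j (θ' j) - ρ j (θ j)) ≤ 3 * τ * t := by
    rw [hθ'j]
    by_cases hneg : θ j < 0
    · rw [if_pos hneg] at ht2
      have h1 : ρ j (θ j + t) ≤ ρ j (θ j) := (hρ j).le_of_abs_le (by
        rw [abs_of_neg (by linarith), abs_of_neg hneg]; linarith)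
      have : lam * (ρ j (θ j + t) - ρ j (θ j)) ≤ 0 :=
        mul_nonpos_of_nonneg_of_nonpos hlam (by linarith)
      have : 0 ≤ 3 * τ * t := by positivity
      linarith
    · rw [if_neg hneg] at ht2
      push Not at hneg
      rcases hlam.eq_or_lt with h0 | hpos
      · rw [← h0]; simp; positivity
      · have h1 := (hρ j).sub_le (C := 3 * τ / lam) hneg (y := θ j + t) (by linarith)
          (fun a ha => by
            rw [le_div_iff₀' hpos]
            exact hflat a ⟨hneg.trans_lt ha.1, by linarith [ha.2]⟩)
        calc _ ≤ lam * (3 * τ / lam * (θ j + t - θ j)) := mul_le_mul_of_nonneg_left h1 hlam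
          _ = _ := by field_simp; ring
  -- The pull `4 * τ` dominates all other terms while both coordinates are below `τ / 4` in modulus,
  -- and `25/8` exceeds the penalty rate `3`.
  have hfit : pairFit hn hd u y i θ' - pairFit hn hd u y i θ ≤ -(25 / 8 * τ) * t := by
    have h0 := abs_lt.1 (hlt false)
    have h1 := abs_lt.1 (hlt true)
    rw [pairFit, pairFit]
    set a := y (pairIdx hn i false) / √(n : ℝ)
    set c := y (pairIdx hn i true) / √(n : ℝ)
    have huc : 0 ≤ u * c := mul_nonneg hu0 hy1
    have hu2 := sq_nonneg u
    cases s
    · have hθ'o : θ' (pairIdx hd i true) = θ (pairIdx hd i true) := hθ'n _ hother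
      rw [hθ'o, hθ'j]
      simp only [Bool.false_eq_true, if_false, one_mul] at hy0
      set p := θ j
      set q := θ (pairIdx hd i true)
      change (a - (p + t - q) / 2) ^ 2 + (c - u * (p + t + q)) ^ 2 -
        ((a - (p - q) / 2) ^ 2 + (c - u * (p + q)) ^ 2) ≤ _
      have hG : -(a - (p - q) / 2) + t / 4 - 2 * (u * c) + u ^ 2 * (2 * (p + q) + t) ≤
          -(25 / 8 * τ) := by
        have : u ^ 2 * (2 * (p + q) + t) ≤ 1 / 4 * (5 / 4 * τ) := by
          calc u ^ 2 * (2 * (p + q) + t) ≤ u ^ 2 * (5 / 4 * τ) :=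
                mul_le_mul_of_nonneg_left (by linarith [h0.2, h1.2]) hu2
            _ ≤ _ := mul_le_mul_of_nonneg_right hu (by linarith)
        linarith [h0.2, h1.1, h1.2, h0.1]
      have := mul_le_mul_of_nonneg_right hG ht0.le
      linarith
    · have hθ'o : θ' (pairIdx hd i false) = θ (pairIdx hd i false) := hθ'n _ hother
      rw [hθ'o, hθ'j]
      simp only [if_true] at hy0
      set q := θ j
      set p := θ (pairIdx hd i false)
      change (a - (p - (q + t)) / 2) ^ 2 + (c - u * (p + (q + t))) ^ 2 -
        ((a - (p - q) / 2) ^ 2 + (c - u * (p + q)) ^ 2) ≤ _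
      have hG : (a - (p - q) / 2) + t / 4 - 2 * (u * c) + u ^ 2 * (2 * (p + q) + t) ≤
          -(25 / 8 * τ) := by
        have : u ^ 2 * (2 * (p + q) + t) ≤ 1 / 4 * (5 / 4 * τ) := by
          calc u ^ 2 * (2 * (p + q) + t) ≤ u ^ 2 * (5 / 4 * τ) :=
                mul_le_mul_of_nonneg_left (by linarith [h0.2, h1.2]) hu2
            _ ≤ _ := mul_le_mul_of_nonneg_right hu (by linarith)
        linarith [h0.2, h1.1, h1.2, h0.1]
      have := mul_le_mul_of_nonneg_right hG ht0.le
      linarith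
  have hpen' : lam * ((ρ (pairIdx hd i false) (θ' (pairIdx hd i false)) -
      ρ (pairIdx hd i false) (θ (pairIdx hd i false))) +
      (ρ (pairIdx hd i true) (θ' (pairIdx hd i true)) -
      ρ (pairIdx hd i true) (θ (pairIdx hd i true)))) ≤ 3 * τ * t := by
    cases s
    · have e : θ' (pairIdx hd i true) = θ (pairIdx hd i true) := hθ'n _ hother
      rw [e, sub_self, add_zero]; exact hpen
    · have e : θ' (pairIdx hd i false) = θ (pairIdx hd i false) := hθ'n _ hother
      rw [e, sub_self, zero_add]; exact hpen
  have : 0 < τ * t := by positivity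
  have hle' : L θ ≤ L θ' := hle
  linarith

end LowerBounds

/-! ### Gaussian probabilities of coordinate boxes. -/

section Gaussian

theorem gaussianReal_apply_eq_std {σ : ℝ} (s : Set ℝ) (hs : MeasurableSet s) :
    gaussianReal 0 (Real.toNNReal (σ ^ 2)) s = gaussianReal 0 1 ((σ * ·) ⁻¹' s) := by
  have h := gaussianReal_map_const_mul (μ := 0) (v := 1) σ
  have e : NNReal.mk (σ ^ 2) (sq_nonneg σ) * 1 = Real.toNNReal (σ ^ 2) := by
    rw [mul_one, Real.toNNReal_of_nonneg (sq_nonneg σ)]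
  rw [mul_zero, e] at h
  rw [← h, Measure.map_apply (by fun_prop) hs]

theorem gaussianReal_std_pos {s : Set ℝ} (hs : volume s ≠ 0) : 0 < gaussianReal 0 1 s :=
  pos_iff_ne_zero.2 fun h => hs (gaussianReal_absolutelyContinuous' 0 one_ne_zero h)

theorem measurableSet_box {m : ℕ} {A : Fin m → Set ℝ} (hA : ∀ j, MeasurableSet (A j))
    (S : Finset (Fin m)) : MeasurableSet {w : EuclideanSpace ℝ (Fin m) | ∀ j ∈ S, w j ∈ A j} := by
  have hset : {w : EuclideanSpace ℝ (Fin m) | ∀ j ∈ S, w j ∈ A j} =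
      ⋂ j ∈ S, (fun w : EuclideanSpace ℝ (Fin m) => w j) ⁻¹' A j := by ext; simp
  rw [hset]
  exact Finset.measurableSet_biInter _ fun j _ => (by fun_prop : Measurable
    fun w : EuclideanSpace ℝ (Fin m) => w j) (hA j)

theorem isoGaussian_box {m : ℕ} (s : ℝ) (A : Fin m → Set ℝ) (hA : ∀ j, MeasurableSet (A j))
    (S : Finset (Fin m)) :
    isoGaussian m s {w | ∀ j ∈ S, w j ∈ A j} =
      ∏ j ∈ S, gaussianReal 0 (Real.toNNReal (s ^ 2)) (A j) := by
  rw [isoGaussian, Measure.map_apply (by fun_prop) (measurableSet_box hA S),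
    ← Measure.pi_pi_finset]
  rfl

end Gaussian

end LocalDescent

namespace LocalDescent

/-! ### Prediction error caused by a missed signal or a spurious coordinate. -/

section PredictionError

variable {n d b : ℕ} (hn : 2 * b ≤ n) (hd : 2 * b ≤ d) {u τ r : ℝ}

/-- The vector with both entries of the `i`-th pair equal to `r / 2` and zeros elsewhere. -/
noncomputable def pairVec (i : Fin b) (r : ℝ) : EuclideanSpace ℝ (Fin d) :=
  WithLp.toLp 2 fun j => if j = pairIdx hd i false ∨ j = pairIdx hd i true then r / 2 else 0

theorem pairVec_same (i : Fin b) (s : Bool) : pairVec hd i r (pairIdx hd i s) = r / 2 := by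
  cases s <;> simp [pairVec]

theorem pairVec_of_ne {i i' : Fin b} (h : i' ≠ i) (s : Bool) :
    pairVec hd i r (pairIdx hd i' s) = 0 := by
  have h1 : ∀ s', pairIdx hd i' s ≠ pairIdx hd i s' := fun s' e => h (pairIdx_inj hd e).1
  simp [pairVec, h1]

theorem pairVec_mem_sparseBall (i : Fin b) {k : ℕ} {R : ℝ} (hk : 2 ≤ k) (hr : 0 ≤ r)
    (hrR : r ≤ R) : pairVec hd i r ∈ sparseBall d k R := by
  constructor
  · refine le_trans (Set.ncard_le_ncard (t := {pairIdx hd i false, pairIdx hd i true}) ?_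
      (Set.toFinite _)) ((Set.ncard_insert_le _ _).trans
        (by rw [Set.ncard_singleton]; exact hk))
    intro j hj
    by_contra h
    simp only [Set.mem_insert_iff, Set.mem_singleton_iff] at h
    exact hj (by simp [pairVec, h])
  · rw [Fintype.sum_eq_add (pairIdx hd i false) (pairIdx hd i true)
      (fun h => by simpa using (pairIdx_inj hd h).2)]
    · rw [pairVec_same, pairVec_same, abs_of_nonneg (by linarith)]
      linarith
    · rintro j ⟨h1, h2⟩
      simp [pairVec, h1, h2]

include hn in
-- The two estimated entries sum to at most `τ / 2 ≤ r / 2` instead of `r`, and the weak row sees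
-- this deficit.
theorem le_predErr_of_le (hn0 : 0 < n) (hτ : 0 ≤ τ) (hr : τ ≤ r) (i : Fin b)
    {θ : EuclideanSpace ℝ (Fin d)} (hθ : ∀ s, θ (pairIdx hd i s) ≤ τ / 4) :
    u ^ 2 * (r / 2) ^ 2 ≤ predErr (pairDesign n d b u) θ (pairVec hd i r) := by
  refine le_trans ?_ (sum_pairFit_le_predErr hn hd hn0 {i} θ (pairVec hd i r))
  rw [Finset.sum_singleton, pairFit_zero_apply]
  simp only [PiLp.sub_apply, pairVec_same]
  have h1 := hθ false
  have h2 := hθ true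
  set p := θ (pairIdx hd i false)
  set q := θ (pairIdx hd i true)
  have h3 : (r / 2) ^ 2 ≤ (p - r / 2 + (q - r / 2)) ^ 2 := by
    rw [← neg_sq (p - r / 2 + (q - r / 2))]
    exact pow_le_pow_left₀ (by linarith) (by linarith) 2
  rw [mul_pow u]
  have := mul_le_mul_of_nonneg_left h3 (sq_nonneg u)
  linarith [sq_nonneg ((p - r / 2 - (q - r / 2)) / 2)]

/-- As `u ^ 2 ≤ 1 / 4`, the block's quadratic form dominates `u ^ 2 * ((p - q) ^ 2 + (p + q) ^ 2) =
2 * u ^ 2 * (p ^ 2 + q ^ 2)`. -/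
theorem le_pairFit_of_le_abs (hu : u ^ 2 ≤ 1 / 4) (hτ : 0 ≤ τ) {i i' : Fin b} (hi : i' ≠ i)
    {θ : EuclideanSpace ℝ (Fin d)} (h : ∃ s, τ / 4 ≤ |θ (pairIdx hd i' s)|) :
    u ^ 2 * τ ^ 2 / 8 ≤ pairFit hn hd u 0 i' (θ - pairVec hd i r) := by
  rw [pairFit_zero_apply]
  simp only [PiLp.sub_apply, pairVec_of_ne hd hi, sub_zero]
  set p := θ (pairIdx hd i' false) with hp
  set q := θ (pairIdx hd i' true) with hq
  have h1 : τ ^ 2 / 16 ≤ p ^ 2 + q ^ 2 := by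
    obtain ⟨s, hs⟩ := h
    have h2 := pow_le_pow_left₀ (by linarith) hs 2
    rw [sq_abs] at h2
    cases s
    · rw [← hp] at h2; nlinarith [sq_nonneg q]
    · rw [← hq] at h2; nlinarith [sq_nonneg p]
  have h3 := mul_le_mul_of_nonneg_left h1 (sq_nonneg u)
  have h4 := mul_le_mul_of_nonneg_right hu (sq_nonneg (p - q))
  linarith

end PredictionError

theorem pow_le_isoGaussian_box {m k : ℕ} {s : ℝ} {A : Fin m → Set ℝ}
    (hA : ∀ j, MeasurableSet (A j)) {S : Finset (Fin m)} {q : ℝ≥0∞} (hq : q ≤ 1)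
    (h : ∀ j ∈ S, q ≤ gaussianReal 0 1 ((s * ·) ⁻¹' A j)) (hS : S.card ≤ k) :
    q ^ k ≤ isoGaussian m s {w | ∀ j ∈ S, w j ∈ A j} := by
  rw [isoGaussian_box s A hA S]
  calc q ^ k ≤ q ^ S.card := pow_le_pow_right_of_le_one' hq hS
    _ = ∏ _j ∈ S, q := (Finset.prod_const q).symm
    _ ≤ _ := Finset.prod_le_prod' fun j hj => by
        rw [gaussianReal_apply_eq_std _ (hA j)]; exact h j hj

/-- A positive lower bound for the standard Gaussian probabilities of three intervals. -/
noncomputable def gaussMin : ℝ≥0∞ :=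
  min (gaussianReal 0 1 (Set.Icc (-1) 1))
    (min (gaussianReal 0 1 (Set.Ici 4)) (gaussianReal 0 1 (Set.Iic (-4))))

theorem gaussMin_pos : 0 < gaussMin := by
  refine lt_min (gaussianReal_std_pos ?_) (lt_min (gaussianReal_std_pos ?_)
    (gaussianReal_std_pos ?_)) <;> simp

theorem gaussMin_le_one : gaussMin ≤ 1 := (min_le_left _ _).trans prob_le_one

/-! ### The favourable events for noise and initial point. -/

section Events

variable {n d b : ℕ} (hn : 2 * b ≤ n) (hd : 2 * b ≤ d) (σ : ℝ)

/-- The noise constraints: bounded on the pair `i₀`, and large on the pair `i`. -/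
def noiseBox (i₀ i : Fin b) (s : Bool) (r : Fin n) : Set ℝ :=
  if r = pairIdx hn i₀ false ∨ r = pairIdx hn i₀ true then Set.Icc (-σ) σ
  else if r = pairIdx hn i false then (if s then Set.Iic (-(4 * σ)) else Set.Ici (4 * σ))
  else Set.Ici 0

/-- The noise is bounded on the pair `i₀` and pulls coordinate `s` of the pair `i` strongly, and
the initial point is nonpositive on the pair `i₀`. -/
def goodEvent (i₀ i : Fin b) (s : Bool) :
    Set (EuclideanSpace ℝ (Fin n) × EuclideanSpace ℝ (Fin d)) :=
  {w | ∀ r ∈ ({pairIdx hn i₀ false, pairIdx hn i₀ true, pairIdx hn i false, pairIdx hn i true} :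
      Finset (Fin n)), w r ∈ noiseBox hn σ i₀ i s r} ×ˢ
    {θ | ∀ j ∈ ({pairIdx hd i₀ false, pairIdx hd i₀ true} : Finset (Fin d)), θ j ∈ Set.Iic (0 : ℝ)}

theorem measurableSet_noiseBox (i₀ i : Fin b) (s : Bool) (r : Fin n) :
    MeasurableSet (noiseBox hn σ i₀ i s r) := by
  unfold noiseBox
  split_ifs <;> measurability

theorem measurableSet_goodEvent (i₀ i : Fin b) (s : Bool) :
    MeasurableSet (goodEvent hn hd σ i₀ i s) :=
  (measurableSet_box (measurableSet_noiseBox hn σ i₀ i s) _).prod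
    (measurableSet_box (fun _ => measurableSet_Iic) _)

instance isProbabilityMeasure_isoGaussian (m : ℕ) (s : ℝ) :
    IsProbabilityMeasure (isoGaussian m s) :=
  Measure.isProbabilityMeasure_map (by fun_prop)

variable {σ} {γ : ℝ}

theorem gaussMin_pow_le_goodEvent (hσ : 0 ≤ σ) (hγ : 0 ≤ γ) (i₀ i : Fin b) (s : Bool) :
    gaussMin ^ 6 ≤ ((isoGaussian n σ).prod (isoGaussian d γ)) (goodEvent hn hd σ i₀ i s) := by
  -- At most four noise coordinates and two initial coordinates are constrained.
  rw [goodEvent, Measure.prod_prod, show 6 = 4 + 2 from rfl, pow_add]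
  refine mul_le_mul' ?_ ?_
  · refine pow_le_isoGaussian_box (measurableSet_noiseBox hn σ i₀ i s) gaussMin_le_one
      (fun r _ => ?_) Finset.card_le_four
    unfold noiseBox
    split_ifs
    · refine (min_le_left _ _).trans (measure_mono fun x hx => ?_)
      exact ⟨by nlinarith [hx.1], by nlinarith [hx.2]⟩
    · refine ((min_le_right _ _).trans (min_le_right _ _)).trans (measure_mono fun x hx => ?_)
      have : x ≤ -4 := hx
      change σ * x ≤ -(4 * σ)
      nlinarith
    · refine ((min_le_right _ _).trans (min_le_left _ _)).trans (measure_mono fun x hx => ?_)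
      have : 4 ≤ x := hx
      change 4 * σ ≤ σ * x
      nlinarith
    · refine ((min_le_right _ _).trans (min_le_left _ _)).trans (measure_mono fun x hx => ?_)
      have : 4 ≤ x := hx
      exact mul_nonneg hσ (by linarith)
  · refine pow_le_isoGaussian_box (fun _ => measurableSet_Iic) gaussMin_le_one
      (fun r _ => ?_) Finset.card_le_two
    -- The closed half-line also covers `γ = 0`, where the start is deterministic.
    refine ((min_le_right _ _).trans (min_le_right _ _)).trans (measure_mono fun x hx => ?_)
    have : x ≤ -4 := hx
    exact mul_nonpos_of_nonneg_of_nonpos hγ (by linarith)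

theorem goodEvent_spec {i₀ i : Fin b} (hi : i ≠ i₀) {s : Bool}
    {p : EuclideanSpace ℝ (Fin n) × EuclideanSpace ℝ (Fin d)}
    (hp : p ∈ goodEvent hn hd σ i₀ i s) :
    (∀ s', |p.1 (pairIdx hn i₀ s')| ≤ σ) ∧ (∀ s', p.2 (pairIdx hd i₀ s') ≤ 0) ∧
      4 * σ ≤ (if s then -1 else 1) * p.1 (pairIdx hn i false) ∧ 0 ≤ p.1 (pairIdx hn i true) := by
  have hne : ∀ s' s'', pairIdx hn i s' ≠ pairIdx hn i₀ s'' := fun s' s'' e =>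
    hi (pairIdx_inj hn e).1
  have hne' : pairIdx hn i true ≠ pairIdx hn i false := fun e => by simpa using (pairIdx_inj hn e).2
  obtain ⟨h1, h2⟩ := hp
  refine ⟨fun s' => ?_, fun s' => ?_, ?_, ?_⟩
  · have h := h1 (pairIdx hn i₀ s') (by cases s' <;> simp)
    rw [noiseBox, if_pos (by cases s' <;> simp)] at h
    exact abs_le.2 h
  · exact h2 (pairIdx hd i₀ s') (by cases s' <;> simp)
  · have h := h1 (pairIdx hn i false) (by simp)
    rw [noiseBox, if_neg (by simp [hne]), if_pos rfl] at h
    cases s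
    · simpa using h
    · have h' : p.1 (pairIdx hn i false) ≤ -(4 * σ) := h
      simp only [if_true]; linarith
  · have h := h1 (pairIdx hn i true) (by simp)
    rw [noiseBox, if_neg (by simp [hne]), if_neg hne'] at h
    exact h

end Events

end LocalDescent

namespace LocalDescent

/-! ### Steep-or-flat dichotomy and the bound on the expectation. -/

section Main

variable {n d b : ℕ} (hn : 2 * b ≤ n) (hd : 2 * b ≤ d) {u τ r σ : ℝ}
  {H lam : ℝ} {reg : EuclideanSpace ℝ (Fin d) → ℝ} {ρ : Fin d → ℝ → ℝ}

theorem apply_pairVec_add_false (i₀ i : Fin b) (w : EuclideanSpace ℝ (Fin n)) :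
    (apply (pairDesign n d b u) (pairVec hd i₀ r) + w) (pairIdx hn i false) =
      w (pairIdx hn i false) := by
  rw [PiLp.add_apply, pairDesign_apply_false hn hd]
  rcases eq_or_ne i i₀ with rfl | h
  · simp [pairVec_same]
  · simp [pairVec_of_ne hd h]

theorem apply_pairVec_add_true_same (i₀ : Fin b) (w : EuclideanSpace ℝ (Fin n)) :
    (apply (pairDesign n d b u) (pairVec hd i₀ r) + w) (pairIdx hn i₀ true) =
      √(n : ℝ) * (u * r) + w (pairIdx hn i₀ true) := by
  rw [PiLp.add_apply, pairDesign_apply_true hn hd, pairVec_same, pairVec_same, add_halves]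

theorem apply_pairVec_add_true_of_ne {i₀ i : Fin b} (h : i ≠ i₀)
    (w : EuclideanSpace ℝ (Fin n)) :
    (apply (pairDesign n d b u) (pairVec hd i₀ r) + w) (pairIdx hn i true) =
      w (pairIdx hn i true) := by
  rw [PiLp.add_apply, pairDesign_apply_true hn hd]
  simp [pairVec_of_ne hd h]

/-- On the good noise event, outputs have large error if the penalty of the pair carrying the
signal is steep near zero. -/
theorem le_predErr_of_steep (hn0 : 0 < n) (hu0 : 0 ≤ u) (hu : u ^ 2 ≤ 1 / 4) (hτ : 0 < τ)
    (hur : u ^ 2 * r ≤ τ / 4) (hr : τ ≤ r) (hστ : σ / √(n : ℝ) = τ)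
    (hreg : ∀ θ, reg θ = ∑ j, ρ j (θ j)) (hρ : ∀ j, IsComponent H (ρ j)) (hlam : 0 ≤ lam)
    {η : ℝ} (hη : η * (lam * H) ≤ τ / 4) {i₀ : Fin b}
    (hsteep : ∀ s, ∃ x ∈ Set.Ioc 0 (τ / 4), 3 * τ ≤ lam * deriv (ρ (pairIdx hd i₀ s)) x)
    {w : EuclideanSpace ℝ (Fin n)} (hw : ∀ s, |w (pairIdx hn i₀ s)| ≤ σ)
    {θ₀ z : EuclideanSpace ℝ (Fin d)} (hθ₀ : ∀ s, θ₀ (pairIdx hd i₀ s) ≤ 0)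
    (hz : z ∈ outputs (loss (pairDesign n d b u) reg
      (apply (pairDesign n d b u) (pairVec hd i₀ r) + w) lam) η θ₀) :
    u ^ 2 * (r / 2) ^ 2 ≤ predErr (pairDesign n d b u) z (pairVec hd i₀ r) := by
  have hsn : 0 < √(n : ℝ) := Real.sqrt_pos.2 (by exact_mod_cast hn0)
  have hwτ : ∀ s, |w (pairIdx hn i₀ s) / √(n : ℝ)| ≤ τ := fun s => by
    rw [abs_div, abs_of_pos hsn, ← hστ]
    exact div_le_div_of_nonneg_right (hw s) hsn.le
  choose x hx hxs using hsteep
  have hu' : u ≤ 1 / 2 := by nlinarith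
  have hzmem : z ∈ {θ : EuclideanSpace ℝ (Fin d) | ∀ s, θ (pairIdx hd i₀ s) ≤ x s} := by
    refine mem_of_mem_outputs hz (fun s => (hθ₀ s).trans (hx s).1.le) fun θ hθ θ' hstep s => ?_
    refine hstep.le_of_steep hn hd hn0 hu hτ hreg hρ hlam hη ?_ ?_ (fun s => (hx s).1)
      (fun s => (hx s).2) hxs hθ s
    · rw [apply_pairVec_add_false]; exact hwτ false
    · rw [apply_pairVec_add_true_same, add_div, mul_div_cancel_left₀ _ hsn.ne']
      -- Signal and noise together pull by at most `u ^ 2 * r + u * τ ≤ τ / 4 + τ / 2`.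
      have h1 := (abs_le.1 (hwτ true)).2
      have h2 := mul_le_mul_of_nonneg_left h1 hu0
      nlinarith
  exact le_predErr_of_le hn hd hn0 hτ.le hr i₀ fun s => (hzmem s).trans (hx s).2

/-- On the good noise event, local minima have an error on every pair whose penalty is flat. -/
theorem le_pairFit_of_flat (hn0 : 0 < n) (hu0 : 0 ≤ u) (hu : u ^ 2 ≤ 1 / 4) (hτ : 0 < τ)
    (hστ : σ / √(n : ℝ) = τ)
    (hreg : ∀ θ, reg θ = ∑ j, ρ j (θ j)) (hρ : ∀ j, IsComponent H (ρ j)) (hlam : 0 ≤ lam)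
    {i₀ i : Fin b} (hi : i ≠ i₀) {s : Bool}
    (hflat : ∀ t ∈ Set.Ioo 0 (τ / 4), lam * deriv (ρ (pairIdx hd i s)) t ≤ 3 * τ)
    {w : EuclideanSpace ℝ (Fin n)} (hw0 : 4 * σ ≤ (if s then -1 else 1) * w (pairIdx hn i false))
    (hw1 : 0 ≤ w (pairIdx hn i true)) {z : EuclideanSpace ℝ (Fin d)}
    (hz : IsLocalMin (loss (pairDesign n d b u) reg
      (apply (pairDesign n d b u) (pairVec hd i₀ r) + w) lam) z) :
    u ^ 2 * τ ^ 2 / 8 ≤ pairFit hn hd u 0 i (z - pairVec hd i₀ r) := by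
  have hsn : 0 < √(n : ℝ) := Real.sqrt_pos.2 (by exact_mod_cast hn0)
  refine le_pairFit_of_le_abs hn hd hu hτ.le hi ?_
  refine exists_le_abs_of_flat hn hd hn0 hu0 hu hτ hreg hρ hlam hflat ?_ ?_ hz
  · rw [apply_pairVec_add_false, ← hστ, ← mul_div_assoc, ← mul_div_assoc]
    exact div_le_div_of_nonneg_right hw0 hsn.le
  · rw [apply_pairVec_add_true_of_ne hn hd hi]
    exact div_nonneg hw1 hsn.le

/-- One coordinate from each pair, and a distinguished pair, such that for every `lam` either both
coordinates of the distinguished pair have a steep penalty, or all selected coordinates have a flat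
penalty. -/
theorem exists_steep_or_flat (hτ : 0 < τ) (hρ : ∀ j, IsComponent H (ρ j)) (hb : 0 < b) :
    ∃ (i₀ : Fin b) (sel : Fin b → Bool), ∀ lam : ℝ, 0 ≤ lam →
      (∀ s, ∃ x ∈ Set.Ioc 0 (τ / 4), 3 * τ ≤ lam * deriv (ρ (pairIdx hd i₀ s)) x) ∨
      ∀ i, ∀ t ∈ Set.Ioo 0 (τ / 4), lam * deriv (ρ (pairIdx hd i (sel i))) t ≤ 3 * τ := by
  have hτ4 : 0 < τ / 4 := by positivity
  set M : Fin d → ℝ := fun j => sSup (deriv (ρ j) '' Set.Ioc 0 (τ / 4))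
  have hsel : ∀ i : Fin b, ∃ s, ∀ s', M (pairIdx hd i s) ≤ M (pairIdx hd i s') := fun i =>
    Finite.exists_min fun s => M (pairIdx hd i s)
  choose sel hsel using hsel
  have : Nonempty (Fin b) := ⟨⟨0, hb⟩⟩
  -- Max-min choice: a large value at `i₀` makes both its coordinates steep, a small one makes every
  -- selected coordinate flat. It does not involve `lam`.
  obtain ⟨i₀, hi₀⟩ := Finite.exists_max fun i => M (pairIdx hd i (sel i))
  refine ⟨i₀, sel, fun lam hlam => ?_⟩
  rcases lt_or_ge (3 * τ) (lam * M (pairIdx hd i₀ (sel i₀))) with h | h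
  · left
    intro s
    have hpos : 0 < lam := hlam.lt_of_ne fun e => by rw [← e, zero_mul] at h; linarith
    have h1 : 3 * τ / lam < M (pairIdx hd i₀ s) :=
      lt_of_lt_of_le ((div_lt_iff₀' hpos).2 h) (hsel i₀ s)
    obtain ⟨_, ⟨x, hx, rfl⟩, hlt⟩ := exists_lt_of_lt_csSup
      ((Set.nonempty_Ioc.2 hτ4).image _) h1
    exact ⟨x, hx, ((div_lt_iff₀' hpos).1 hlt).le⟩
  · right
    intro i t ht
    have h1 : deriv (ρ (pairIdx hd i (sel i))) t ≤ M (pairIdx hd i (sel i)) :=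
      le_csSup ((hρ _).bddAbove_deriv hτ4) ⟨t, ⟨ht.1, ht.2.le⟩, rfl⟩
    exact (mul_le_mul_of_nonneg_left (h1.trans (hi₀ i)) hlam).trans h

include hn in
/-- The worst-case lower bound for the pair design. -/
theorem le_lintegral_iInf_predErr (hn0 : 0 < n) (hb : 2 ≤ b) (hnb : n ≤ 5 * (b - 1))
    (hu0 : 0 ≤ u) (hu : u ^ 2 ≤ 1 / 4) (hσ : 0 < σ) (hur : u ^ 2 * r = σ / √(n : ℝ) / 4)
    (hr : σ / √(n : ℝ) ≤ r) (hrσ : r ≤ σ) {γ : ℝ} (hγ : 0 ≤ γ)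
    (hreg : ∀ θ, reg θ = ∑ j, ρ j (θ j)) (hρ : ∀ j, IsComponent H (ρ j)) :
    ∃ i₀ : Fin b, gaussMin ^ 6 * ENNReal.ofReal (r * (σ / √(n : ℝ)) / 160) ≤
      ∫⁻ p : EuclideanSpace ℝ (Fin n) × EuclideanSpace ℝ (Fin d),
        (⨅ (lam : ℝ) (_ : 0 ≤ lam) (η : ℝ) (_ : AdmissibleStepsize n σ H lam η),
          ⨅ θhat ∈ outputs (loss (pairDesign n d b u) reg
            (apply (pairDesign n d b u) (pairVec hd i₀ r) + p.1) lam) η p.2,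
            ENNReal.ofReal (predErr (pairDesign n d b u) θhat (pairVec hd i₀ r)))
        ∂((isoGaussian n σ).prod (isoGaussian d γ)) := by
  classical
  have hsn : 0 < √(n : ℝ) := Real.sqrt_pos.2 (by exact_mod_cast hn0)
  obtain ⟨τ, hτdef⟩ : ∃ τ, σ / √(n : ℝ) = τ := ⟨_, rfl⟩
  have hτ : 0 < τ := hτdef ▸ div_pos hσ hsn
  rw [hτdef] at hur hr ⊢
  have hr0 : 0 < r := hτ.trans_le hr
  obtain ⟨i₀, sel, hsel⟩ := exists_steep_or_flat hd hτ hρ (by omega)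
  refine ⟨i₀, ?_⟩
  set S : Finset (Fin b) := Finset.univ.erase i₀
  have hcard : S.card = b - 1 := by simp [S]
  have hm0 : (0 : ℝ) < S.card := by rw [hcard]; exact_mod_cast (by omega : 0 < b - 1)
  set D : ℝ := r * τ / 160
  have hD0 : 0 ≤ D := by positivity
  have hmD : (S.card : ℝ) * (D / S.card) = D := mul_div_cancel₀ _ hm0.ne'
  have hDsteep : D ≤ u ^ 2 * (r / 2) ^ 2 := by
    have : u ^ 2 * (r / 2) ^ 2 = τ * r / 16 := by
      linear_combination (r / 4) * hur
    rw [this]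
    have : 0 < r * τ := by positivity
    simp only [D]; linarith
  -- Here `r ≤ σ` enters: `r ^ 2 ≤ σ ^ 2 = n * τ ^ 2 ≤ 5 * S.card * τ ^ 2`, and `160 = 5 * 32` with
  -- `u ^ 2 * r = τ / 4`.
  have hDflat : D / S.card ≤ u ^ 2 * τ ^ 2 / 8 := by
    rw [div_le_iff₀ hm0]
    have h1 : σ ^ 2 = n * τ ^ 2 := by
      rw [← hτdef, div_pow, Real.sq_sqrt (Nat.cast_nonneg n)]
      field_simp
    have h2 : (n : ℝ) ≤ 5 * S.card := by rw [hcard]; exact_mod_cast hnb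
    have h3 : r ^ 2 ≤ 5 * S.card * τ ^ 2 := by
      calc r ^ 2 ≤ σ ^ 2 := pow_le_pow_left₀ hr0.le hrσ 2
        _ = n * τ ^ 2 := h1
        _ ≤ _ := mul_le_mul_of_nonneg_right h2 (sq_nonneg _)
    refine le_of_mul_le_mul_left ?_ hr0
    calc r * D = r ^ 2 * (τ / 160) := by simp only [D]; ring
      _ ≤ 5 * S.card * τ ^ 2 * (τ / 160) := mul_le_mul_of_nonneg_right h3 (by positivity)
      _ = r * (u ^ 2 * τ ^ 2 / 8 * S.card) := by
        linear_combination (-(τ ^ 2 * S.card / 8)) * hur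
  set E : Fin b → Set (EuclideanSpace ℝ (Fin n) × EuclideanSpace ℝ (Fin d)) :=
    fun i => goodEvent hn hd σ i₀ i (sel i)
  have hE : ∀ i, MeasurableSet (E i) := fun i => measurableSet_goodEvent hn hd σ i₀ i (sel i)
  -- A measurable minorant, the sum of the indicators of `E i` weighted by `D / S.card`, is
  -- integrated, so measurability of the infimum is never needed.
  calc gaussMin ^ 6 * ENNReal.ofReal D
      = ∑ _i ∈ S, ENNReal.ofReal (D / S.card) * gaussMin ^ 6 := by
        rw [Finset.sum_const, nsmul_eq_mul, ← mul_assoc, mul_comm, ← ENNReal.ofReal_natCast,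
          ← ENNReal.ofReal_mul hm0.le, hmD]
    _ ≤ ∑ i ∈ S, ENNReal.ofReal (D / S.card) *
          ((isoGaussian n σ).prod (isoGaussian d γ)) (E i) :=
        Finset.sum_le_sum fun i _ => mul_le_mul_right
          (gaussMin_pow_le_goodEvent hn hd hσ.le hγ i₀ i (sel i)) _
    _ = ∫⁻ p, ∑ i ∈ S, (E i).indicator (fun _ => ENNReal.ofReal (D / S.card)) p
          ∂((isoGaussian n σ).prod (isoGaussian d γ)) := by
        rw [lintegral_finsetSum _ fun i _ => measurable_const.indicator (hE i)]
        exact Finset.sum_congr rfl fun i _ => (lintegral_indicator_const (hE i) _).symm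
    _ ≤ _ := lintegral_mono fun p => ?_
  refine le_iInf₂ fun lam hlam => le_iInf₂ fun η hη => le_iInf₂ fun z hz => ?_
  have hη' : η * (lam * H) ≤ τ / 4 := by
    have := hη.2.2
    rw [mul_comm 4, ← div_div, hτdef] at this
    exact this
  have hind : ∀ i ∈ S, (E i).indicator (fun _ => ENNReal.ofReal (D / S.card)) p =
      ENNReal.ofReal (if p ∈ E i then D / S.card else 0) := fun i _ => by
    rw [Set.indicator_apply]; split_ifs <;> simp
  have hterm : ∀ i, (0 : ℝ) ≤ if p ∈ E i then D / S.card else 0 := fun i => by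
    split_ifs
    exacts [div_nonneg hD0 hm0.le, le_rfl]
  rw [Finset.sum_congr rfl hind, ← ENNReal.ofReal_sum_of_nonneg fun i _ => hterm i]
  refine ENNReal.ofReal_le_ofReal ?_
  have hspec : ∀ i ∈ S, p ∈ E i → _ := fun i hi hp =>
    goodEvent_spec hn hd (Finset.ne_of_mem_erase hi) hp
  rcases hsel lam hlam with h | h
  -- In the steep case one event suffices: each `E i` constrains the pair `i₀`, and the minorant
  -- never exceeds `D`.
  · by_cases hp : ∃ i ∈ S, p ∈ E i
    · obtain ⟨i, hi, hp⟩ := hp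
      obtain ⟨hw, hθ₀, -, -⟩ := hspec i hi hp
      refine le_trans ?_ (hDsteep.trans (le_predErr_of_steep hn hd hn0 hu0 hu hτ hur.le hr hτdef
        hreg hρ hlam hη' h hw hθ₀ hz))
      calc ∑ i ∈ S, (if p ∈ E i then D / S.card else 0) ≤ ∑ _i ∈ S, D / S.card :=
            Finset.sum_le_sum fun i _ => by
              split_ifs
              exacts [le_rfl, div_nonneg hD0 hm0.le]
        _ = D := by rw [Finset.sum_const, nsmul_eq_mul, hmD]
    · push Not at hp
      rw [Finset.sum_eq_zero fun i hi => if_neg (hp i hi)]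
      unfold predErr; positivity
  · refine le_trans (Finset.sum_le_sum fun i hi => ?_)
      (sum_pairFit_le_predErr hn hd hn0 S z (pairVec hd i₀ r))
    split_ifs with hp
    · obtain ⟨-, -, hw0, hw1⟩ := hspec i hi hp
      exact hDflat.trans (le_pairFit_of_flat hn hd hn0 hu0 hu hτ hτdef hreg hρ hlam
        (Finset.ne_of_mem_erase hi) (h i) hw0 hw1 (isLocalMin_of_mem_outputs hz))
    · exact pairFit_nonneg hn hd 0 i _

end Main

end LocalDescent

theorem theorem2 :
    ∃ c : ℝ, 0 < c ∧
      ∀ (n d k : ℕ) (σ γ R : ℝ), 4 ≤ n → n ≤ d → 2 ≤ k → 0 < σ → 0 ≤ γ → σ / √(n : ℝ) ≤ R →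
      ∃ X : Matrix (Fin n) (Fin d) ℝ, LocalDescent.ColumnNormalized X ∧
        ∀ (H : ℝ) (reg : EuclideanSpace ℝ (Fin d) → ℝ), LocalDescent.IsRegularizer H reg →
          -- (a) runs exist, and every run terminates finitely at a local minimum
          (∀ (y : EuclideanSpace ℝ (Fin n)) (lam η : ℝ), 0 ≤ lam →
            LocalDescent.AdmissibleStepsize n σ H lam η →
            ∀ θ₀ : EuclideanSpace ℝ (Fin d),
              (∃ θ : ℕ → EuclideanSpace ℝ (Fin d), θ 0 = θ₀ ∧
                ∀ t, LocalDescent.IsStep (LocalDescent.loss X reg y lam) η (θ t) (θ (t + 1))) ∧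
              ∀ θ : ℕ → EuclideanSpace ℝ (Fin d), θ 0 = θ₀ →
                (∀ t, LocalDescent.IsStep (LocalDescent.loss X reg y lam) η
                  (θ t) (θ (t + 1))) →
                ∃ T, LocalDescent.TerminatesAt (LocalDescent.loss X reg y lam) η θ T ∧
                  IsLocalMin (LocalDescent.loss X reg y lam) (θ (T + 1))) ∧
          -- (b) lower bound on the worst-case expected prediction error; `p = (w, θ⁰)`
          ENNReal.ofReal (c * min R σ * (σ / √(n : ℝ))) ≤
            ⨆ θs ∈ LocalDescent.sparseBall d k R,
              ∫⁻ p : EuclideanSpace ℝ (Fin n) × EuclideanSpace ℝ (Fin d),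
                (⨅ (lam : ℝ) (_ : 0 ≤ lam) (η : ℝ)
                  (_ : LocalDescent.AdmissibleStepsize n σ H lam η),
                  ⨅ θhat ∈ LocalDescent.outputs
                      (LocalDescent.loss X reg (LocalDescent.apply X θs + p.1) lam) η p.2,
                    ENNReal.ofReal (LocalDescent.predErr X θhat θs))
                ∂((LocalDescent.isoGaussian n σ).prod (LocalDescent.isoGaussian d γ)) := by
  refine ⟨(LocalDescent.gaussMin ^ 6).toReal / 160, ?_, ?_⟩
  · have h1 : LocalDescent.gaussMin ^ 6 ≠ 0 := pow_ne_zero 6 LocalDescent.gaussMin_pos.ne'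
    have h2 : LocalDescent.gaussMin ^ 6 ≠ ⊤ :=
      ENNReal.pow_ne_top (LocalDescent.gaussMin_le_one.trans_lt ENNReal.one_lt_top).ne
    exact div_pos (ENNReal.toReal_pos h1 h2) (by norm_num)
  intro n d k σ γ R hn4 hnd hk hσ hγ hR
  have hn0 : 0 < n := by omega
  have hsn : 1 ≤ √(n : ℝ) := Real.one_le_sqrt.2 (by exact_mod_cast hn0)
  have hτ : 0 < σ / √(n : ℝ) := by positivity
  set r := min R σ with hrdef
  have hr : σ / √(n : ℝ) ≤ r := le_min hR (div_le_self hσ.le hsn)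
  have hr0 : 0 < r := hτ.trans_le hr
  -- Both error bounds grow with `u`; this is the largest value with `u ^ 2 * r ≤ τ / 4`, as the
  -- barrier argument requires.
  set u := √(σ / √(n : ℝ) / (4 * r)) with hudef
  have hu0 : 0 < u := Real.sqrt_pos.2 (by positivity)
  have husq : u ^ 2 = σ / √(n : ℝ) / (4 * r) := Real.sq_sqrt (by positivity)
  have hu : u ^ 2 ≤ 1 / 4 := by
    rw [husq, div_le_iff₀ (by positivity)]; linarith
  have hur : u ^ 2 * r = σ / √(n : ℝ) / 4 := by rw [husq]; field_simp
  have hbn : 2 * (n / 2) ≤ n := by omega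
  have hbd : 2 * (n / 2) ≤ d := by omega
  refine ⟨LocalDescent.pairDesign n d (n / 2) u,
    LocalDescent.columnNormalized_pairDesign hbn hbd u hn0 hu, fun H reg hR' => ⟨?_, ?_⟩⟩
  · intro y lam η hlam hη θ₀
    have hcont := hR'.continuous_loss (LocalDescent.pairDesign n d (n / 2) u) y lam
    refine ⟨LocalDescent.exists_run hcont hη.1.le θ₀, fun θ _ hstep => ?_⟩
    obtain ⟨ρ, hreg, hρ⟩ := hR'
    exact LocalDescent.exists_terminatesAt_isLocalMin hcont hη.1 hstep
      (LocalDescent.isBounded_run hbn hbd hn0 hu0 hreg hρ hlam hη.1.le hstep)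
  · obtain ⟨ρ, hreg, hρ⟩ := hR'
    -- With `b = n / 2`, the inequality `n ≤ 5 * (b - 1)` holds for all `n ≥ 4`, with equality at `n
    -- = 5`.
    obtain ⟨i₀, h⟩ := LocalDescent.le_lintegral_iInf_predErr hbn hbd hn0 (by omega) (by omega)
      hu0.le hu hσ hur hr (min_le_right _ _) hγ hreg hρ
    refine le_trans ?_ (le_iSup₂_of_le (LocalDescent.pairVec hbd i₀ r)
      (LocalDescent.pairVec_mem_sparseBall hbd i₀ hk hr0.le (min_le_left _ _)) h)
    have h2 : LocalDescent.gaussMin ^ 6 ≠ ⊤ :=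
      ENNReal.pow_ne_top (LocalDescent.gaussMin_le_one.trans_lt ENNReal.one_lt_top).ne
    rw [show (LocalDescent.gaussMin ^ 6).toReal / 160 * r * (σ / √(n : ℝ)) =
      (LocalDescent.gaussMin ^ 6).toReal * (r * (σ / √(n : ℝ)) / 160) by ring,
      ENNReal.ofReal_mul ENNReal.toReal_nonneg, ENNReal.ofReal_toReal h2]
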